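/- Let $p_1,p_2\ge 1$ and let $X=(X_1,X_2)$, $X_i\in\mathbb R^{p_i}$, be jointly Gaussian with mean $0$ and covariance matrix $Q=\begin{pmatrix}Q_{X_1}&Q_{X_1,X_2}\\Q_{X_1,X_2}^{T}&Q_{X_2}\end{pmatrix}\succ0$. For $\Delta_1,\Delta_2\in[0,\infty)$ let $$R_{X_1,X_2}(\Delta_1,\Delta_2)=\inf\ I(X_1,X_2;\widehat X_1,\widehat X_2)\in[0,\infty]$$ (natural logarithms), where the infimum is over all joint laws of $(X_1,X_2,\widehat X_1,\widehat X_2)$ on $\mathbb R^{p_1}\times\mathbb R^{p_2}\times\mathbb R^{p_1}\times\mathbb R^{p_2}$ with the given $(X_1,X_2)$-marginal and $\mathbf E\|X_i-\widehat X_i\|^2\le\Delta_i$, $i=1,2$. Infima over the empty set are $+\infty$. *Canonical variable form.* Let $S\succ 0$ be a symmetric $(p_1+p_2)\times(p_1+p_2)$ matrix with blocks $S_{11},S_{12},S_{22}$. Its canonical variable form is obtained as follows. (1) Write $S_{ii}=U_iD_iU_i^T$, $i=1,2$, with $U_i$ orthogonal and $D_i=\mathrm{diag}(d_{i,1},\dots,d_{i,p_i})$,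 $d_{i,1}\ge\dots\ge d_{i,p_i}>0$. (2) Write $D_1^{-1/2}U_1^TS_{12}U_2D_2^{-1/2}=U_3D_3U_4^T$ with $U_3,U_4$ orthogonal and $D_3=\text{Block-diag}(I_{p_{11}},D_4,0_{p_{13}\times p_{23}})\in\mathbb R^{p_1\times p_2}$, $D_4=\mathrm{diag}(d_{4,1},\dots,d_{4,p_{12}})$, $1>d_{4,1}\ge\dots\ge d_{4,p_{12}}>0$, where $p_i=p_{i1}+p_{i2}+p_{i3}$, $p_{11}=p_{21}$, $p_{12}=p_{22}$ (all these indices are integers $\ge0$). (3) Put $S_{\rm cvf}=\begin{pmatrix}I_{p_1}&D_3\\D_3^T&I_{p_2}\end{pmatrix}$, $S_1=U_3^TD_1^{-1/2}U_1^T$, $S_2=U_4^TD_2^{-1/2}U_2^T$. The following hold. (i) Every $S\succ0$ has a canonical variable form with $p_{11}=p_{21}=0$. For every canonical variable form of $S$, the transformation $\text{Block-diag}(S_1,S_2)\,S\,\text{Block-diag}(S_1,S_2)^T=S_{\rm cvf}$ holds. (ii) With $\frac12\log(\det Q/\det\Sigma)=+\infty$ if $\det\Sigma=0$, $$R_{X_1,X_2}(\Delta_1,\Delta_2)=\inf\Big\{\tfrac12\log\frac{\det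 Q}{\det\Sigma}:\ Q\succeq\Sigma\succeq0,\ \operatorname{tr}\Sigma_{11}\le\Delta_1,\ \operatorname{tr}\Sigma_{22}\le\Delta_2\Big\}.$$ (iii) Let $D_1,D_2,D_3,Q_{\rm cvf}$ come from a canonical variable form of $Q$ with $p_{11}=p_{21}=0$. Then $p_1=p_{12}+p_{13}$, $p_2=p_{22}+p_{23}$ and $$R_{X_1,X_2}(\Delta_1,\Delta_2)=\inf\ \frac12\log\frac{\det(D_1)\det(D_2)\det(Q_{\rm cvf})}{\det(\overline D_1)\det(\overline D_2)\det(\Sigma_{\rm cvf})},$$ where the infimum is over all canonical parameters $\overline n\ge 0$, $\overline d_{4,1}\ge\dots\ge\overline d_{4,\overline n}$ in $(0,1)$, $\overline d_{1,1}\ge\dots\ge\overline d_{1,p_1}>0$, $\overline d_{2,1}\ge\dots\ge\overline d_{2,p_2}>0$ such that $\sum_i\overline d_{1,i}\le\Delta_1$, $\sum_i\overline d_{2,i}\le\Delta_2$, and some $\Sigma\succ0$ with $Q-\Sigma\succeq0$ has a canonical variable form with these parameters, with $\overline p_{11}=\overline p_{21}=0$ and $\overline p_{12}=\overline p_{22}=\overline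 n$; here $\overline D_1,\overline D_2,\overline D_3,\Sigma_{\rm cvf}$ denote the matrices of that form. (iv) For all parameters allowed in (iii), $p_1=\overline n+\overline p_{13}$, $p_2=\overline n+\overline p_{23}$, and $$\det\Sigma_{\rm cvf}=\det\big(I_{p_1}-\overline D_3\overline D_3^T\big)=\begin{cases}1,&\overline n=0,\ \overline p_{13}>0,\ \overline p_{23}>0,\\ \prod_{i=1}^{\overline n}(1-\overline d_{4,i}^2),&\overline p_{13}\ge0,\ \overline p_{23}\ge0.\end{cases}$$ -/

import Mathlib

open MeasureTheory ProbabilityTheory InformationTheory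
open scoped ENNReal NNReal Matrix

namespace JointRDF

noncomputable section

/-! ### The joint rate distortion function -/

/-- Mutual information of the two components of a joint law, in nats: the divergence of the joint
law from the product of its marginals. -/
def mutualInfo {A B : Type*} [MeasurableSpace A] [MeasurableSpace B] (π : Measure (A × B)) :
    ℝ≥0∞ :=
  klDiv π (π.fst.prod π.snd)

/-- The joint laws of `((X₁, X₂), (X̂₁, X̂₂))` whose `(X₁, X₂)`-marginal is the source law `μ` and
whose two average distortions are at most `Δ₁` and `Δ₂`. -/
def admissibleLaws {A₁ A₂ B₁ B₂ : Type*} [MeasurableSpace A₁] [MeasurableSpace A₂]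
    [MeasurableSpace B₁] [MeasurableSpace B₂] (μ : Measure (A₁ × A₂))
    (d₁ : A₁ → B₁ → ℝ≥0) (d₂ : A₂ → B₂ → ℝ≥0) (Δ₁ Δ₂ : ℝ≥0) :
    Set (Measure ((A₁ × A₂) × (B₁ × B₂))) :=
  {π | π.fst = μ ∧
    (∫⁻ z, (d₁ z.1.1 z.2.1 : ℝ≥0∞) ∂π) ≤ Δ₁ ∧
    (∫⁻ z, (d₂ z.1.2 z.2.2 : ℝ≥0∞) ∂π) ≤ Δ₂}

/-- The joint RDF with individual distortion criteria. -/
def jointRDF {A₁ A₂ B₁ B₂ : Type*} [MeasurableSpace A₁] [MeasurableSpace A₂]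
    [MeasurableSpace B₁] [MeasurableSpace B₂] (μ : Measure (A₁ × A₂))
    (d₁ : A₁ → B₁ → ℝ≥0) (d₂ : A₂ → B₂ → ℝ≥0) (Δ₁ Δ₂ : ℝ≥0) : ℝ≥0∞ :=
  ⨅ π ∈ admissibleLaws μ d₁ d₂ Δ₁ Δ₂, mutualInfo π

/-- Square-error distortion on `ℝᵖ`. -/
def sqDist {p : ℕ} (x y : EuclideanSpace ℝ (Fin p)) : ℝ≥0 := ‖x - y‖₊ ^ 2

/-- The column vector `(xᵀ, yᵀ)ᵀ`. -/
def stack {p₁ p₂ : ℕ} (x : EuclideanSpace ℝ (Fin p₁)) (y : EuclideanSpace ℝ (Fin p₂)) :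
    EuclideanSpace ℝ (Fin p₁ ⊕ Fin p₂) :=
  WithLp.toLp 2 (Sum.elim (fun i => x i) (fun j => y j))

/-! ### The characterization by error covariances -/

/-- The error covariances `S` with `0 ⪯ S ⪯ Q` whose diagonal blocks have traces at most
`Δ₁` and `Δ₂`. -/
def feasibleCov {p₁ p₂ : ℕ} (Q : Matrix (Fin p₁ ⊕ Fin p₂) (Fin p₁ ⊕ Fin p₂) ℝ) (Δ₁ Δ₂ : ℝ≥0) :
    Set (Matrix (Fin p₁ ⊕ Fin p₂) (Fin p₁ ⊕ Fin p₂) ℝ) :=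
  {S | S.PosSemidef ∧ (Q - S).PosSemidef ∧
    S.toBlocks₁₁.trace ≤ Δ₁ ∧ S.toBlocks₂₂.trace ≤ Δ₂}

open Classical in
/-- `½ log (det Q / det S)`, which is `+∞` when `det S = 0`. -/
def halfLogDetRatio {p₁ p₂ : ℕ} (Q S : Matrix (Fin p₁ ⊕ Fin p₂) (Fin p₁ ⊕ Fin p₂) ℝ) : EReal :=
  if S.det = 0 then ⊤ else ((1 / 2 * Real.log (Q.det / S.det) : ℝ) : EReal)

/-! ### The canonical variable form -/

/-- The shape and the numerical parameters of a canonical variable form. The equalities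
`p₁₁ = p₂₁` and `p₁₂ = p₂₂` of the two decompositions `pᵢ = pᵢ₁ + pᵢ₂ + pᵢ₃` are built in:
`p11` stands for `p₁₁ = p₂₁` and `p12` for `p₁₂ = p₂₂`. -/
structure CvfParams (p₁ p₂ : ℕ) where
  p11 : ℕ
  p12 : ℕ
  p13 : ℕ
  p23 : ℕ
  dim₁ : p₁ = p11 + p12 + p13
  dim₂ : p₂ = p11 + p12 + p23
  d₁ : Fin p₁ → ℝ
  d₂ : Fin p₂ → ℝ
  d₄ : Fin p12 → ℝ

namespace CvfParams

variable {p₁ p₂ : ℕ} (θ : CvfParams p₁ p₂)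

/-- `D₁ = diag(d₁,₁, …)`. -/
def D₁ : Matrix (Fin p₁) (Fin p₁) ℝ := Matrix.diagonal θ.d₁

/-- `D₂ = diag(d₂,₁, …)`. -/
def D₂ : Matrix (Fin p₂) (Fin p₂) ℝ := Matrix.diagonal θ.d₂

/-- `D₁ ^ (-1/2)`. -/
def D₁InvSqrt : Matrix (Fin p₁) (Fin p₁) ℝ := Matrix.diagonal fun i => (√(θ.d₁ i))⁻¹

/-- `D₂ ^ (-1/2)`. -/
def D₂InvSqrt : Matrix (Fin p₂) (Fin p₂) ℝ := Matrix.diagonal fun i => (√(θ.d₂ i))⁻¹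

/-- `D₃ = Block-diag(I, D₄, 0)`, a `p₁ × p₂` matrix, where `D₄ = diag(d₄,₁, …)`. -/
def D₃ : Matrix (Fin p₁) (Fin p₂) ℝ :=
  Matrix.of fun i j =>
    if i.val = j.val then
      if i.val < θ.p11 then 1
      else if h : i.val - θ.p11 < θ.p12 then θ.d₄ ⟨i.val - θ.p11, h⟩
      else 0
    else 0

/-- The variance matrix in canonical variable form. -/
def Qcvf : Matrix (Fin p₁ ⊕ Fin p₂) (Fin p₁ ⊕ Fin p₂) ℝ :=
  Matrix.fromBlocks 1 θ.D₃ θ.D₃ᵀ 1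

end CvfParams

/-- The orthogonal matrices `U₁, U₂, U₃, U₄` of the algorithm. -/
structure CvfBases (p₁ p₂ : ℕ) where
  U₁ : Matrix (Fin p₁) (Fin p₁) ℝ
  U₂ : Matrix (Fin p₂) (Fin p₂) ℝ
  U₃ : Matrix (Fin p₁) (Fin p₁) ℝ
  U₄ : Matrix (Fin p₂) (Fin p₂) ℝ
  orth₁ : U₁ ∈ Matrix.orthogonalGroup (Fin p₁) ℝ
  orth₂ : U₂ ∈ Matrix.orthogonalGroup (Fin p₂) ℝ
  orth₃ : U₃ ∈ Matrix.orthogonalGroup (Fin p₁) ℝ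
  orth₄ : U₄ ∈ Matrix.orthogonalGroup (Fin p₂) ℝ

/-- `(θ, U)` is an output of the algorithm that brings the variance matrix `Q ≻ 0` to its canonical
variable form. -/
structure IsCvf {p₁ p₂ : ℕ} (Q : Matrix (Fin p₁ ⊕ Fin p₂) (Fin p₁ ⊕ Fin p₂) ℝ)
    (θ : CvfParams p₁ p₂) (U : CvfBases p₁ p₂) : Prop where
  posDef : Q.PosDef
  d₁_pos : ∀ i, 0 < θ.d₁ i
  d₂_pos : ∀ i, 0 < θ.d₂ i
  d₄_mem : ∀ i, θ.d₄ i ∈ Set.Ioo (0 : ℝ) 1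
  d₁_anti : Antitone θ.d₁
  d₂_anti : Antitone θ.d₂
  d₄_anti : Antitone θ.d₄
  svd₁ : Q.toBlocks₁₁ = U.U₁ * θ.D₁ * U.U₁ᵀ
  svd₂ : Q.toBlocks₂₂ = U.U₂ * θ.D₂ * U.U₂ᵀ
  svd₃ : θ.D₁InvSqrt * U.U₁ᵀ * Q.toBlocks₁₂ * U.U₂ * θ.D₂InvSqrt = U.U₃ * θ.D₃ * U.U₄ᵀ

/-- The transformation `Block-diag(S₁, S₂)` to canonical variables, with
`S₁ = U₃ᵀ D₁^(-1/2) U₁ᵀ` and `S₂ = U₄ᵀ D₂^(-1/2) U₂ᵀ`. -/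
def cvfTransform {p₁ p₂ : ℕ} (θ : CvfParams p₁ p₂) (U : CvfBases p₁ p₂) :
    Matrix (Fin p₁ ⊕ Fin p₂) (Fin p₁ ⊕ Fin p₂) ℝ :=
  Matrix.fromBlocks (U.U₃ᵀ * θ.D₁InvSqrt * U.U₁ᵀ) 0 0 (U.U₄ᵀ * θ.D₂InvSqrt * U.U₂ᵀ)

/-- The canonical parameters `(n̄, d̄₁, d̄₂, d̄₄)`, with `p̄₁₁ = p̄₂₁ = 0`, of the error covariances
`S` with `Q - S ⪰ 0`, subject to the two trace constraints. The ranges `d̄₁,ᵢ, d̄₂,ᵢ > 0` and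
`0 < d̄₄,ᵢ < 1` and the orderings are part of `IsCvf`. -/
def feasibleParams {p₁ p₂ : ℕ} (Q : Matrix (Fin p₁ ⊕ Fin p₂) (Fin p₁ ⊕ Fin p₂) ℝ)
    (Δ₁ Δ₂ : ℝ≥0) : Set (CvfParams p₁ p₂) :=
  {θ | θ.p11 = 0 ∧ ∑ i, θ.d₁ i ≤ Δ₁ ∧ ∑ i, θ.d₂ i ≤ Δ₂ ∧
    ∃ (S : Matrix (Fin p₁ ⊕ Fin p₂) (Fin p₁ ⊕ Fin p₂) ℝ) (U : CvfBases p₁ p₂),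
      IsCvf S θ U ∧ (Q - S).PosSemidef}

end

end JointRDF

/-! Both bounds on the rate come from one object, the backward channel x = K y + n with Gaussian
noise n of covariance T. Whatever the law ν of y, the joint law of (x, y) has an explicit density
with respect to N(0, Q) ⊗ ν, the exponential of `channelLogLik` (`withDensity_channelLogLik`).

Converse (`exists_errorCov_le_mutualInfo`): take for ν the actual reproduction law, for K the least
squares estimator, and let S be the second moment matrix of its error. By Pythagoras, 0 ⪯ S ⪯ Q, and
the diagonal of S is at most the mean square errors. The density has mass one, so the
Donsker–Varadhan bound `integral_le_toReal_klDiv` bounds the mutual information below by the mean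
log-likelihood; for T = S + εI this is at least ½ log(det Q / det T). Let ε → 0.

Achievability (`exists_law_of_errorCov`): for K = 1, T = S ≻ 0 and ν = N(0, Q − S), the law of x is
N(0, Q). The density is then taken against the product of the channel's own marginals, and the mean
of its logarithm is exactly ½ log(det Q / det S).

The canonical form only reparametrizes this problem. The determinant of S and the traces of its
diagonal blocks are functions of the canonical parameters (`IsCvf.det_eq`, `IsCvf.trace_eq`). Every
S ≻ 0 has a form with `p11 = 0` (`exists_isCvf`), because whitening turns its cross block into a
strict contraction. Singular S cost +∞ and can be dropped. -/

namespace JointRDF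

/-! ### Gaussian densities with respect to Lebesgue measure. -/

section GaussianDensity

open scoped RealInnerProductSpace MatrixOrder

variable {ι : Type*} [Fintype ι]

/-- The quadratic form `xᵀ A x`. -/
noncomputable def quadForm (A : Matrix ι ι ℝ) (x : EuclideanSpace ℝ ι) : ℝ :=
  x.ofLp ⬝ᵥ A *ᵥ x.ofLp

lemma continuous_quadForm (A : Matrix ι ι ℝ) : Continuous (quadForm A) := by
  unfold quadForm dotProduct Matrix.mulVec dotProduct
  fun_prop

lemma quadForm_eq_sum (A : Matrix ι ι ℝ) (x : EuclideanSpace ℝ ι) :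
    quadForm A x = ∑ i, ∑ j, A i j * (x i * x j) := by
  simp only [quadForm, dotProduct, Matrix.mulVec, Finset.mul_sum]
  exact Finset.sum_congr rfl fun i _ => Finset.sum_congr rfl fun j _ => by ring

variable [DecidableEq ι]

/-- The logarithm of the density of the centered Gaussian law with covariance matrix `S`. -/
noncomputable def logDensity (S : Matrix ι ι ℝ) (x : EuclideanSpace ℝ ι) : ℝ :=
  -(Fintype.card ι / 2 * Real.log (2 * Real.pi)) - 1 / 2 * Real.log S.det
    - 1 / 2 * quadForm S⁻¹ x

@[fun_prop]
lemma continuous_logDensity (S : Matrix ι ι ℝ) : Continuous (logDensity S) := by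
  have := continuous_quadForm S⁻¹
  unfold logDensity
  fun_prop

lemma logDensity_one (x : EuclideanSpace ℝ ι) :
    logDensity 1 x =
      -(Fintype.card ι / 2 * Real.log (2 * Real.pi)) - 1 / 2 * ‖x‖ ^ 2 := by
  rw [EuclideanSpace.real_norm_sq_eq]
  simp [logDensity, quadForm, dotProduct, sq]

lemma exp_logDensity_one (x : EuclideanSpace ℝ ι) :
    Real.exp (logDensity 1 x) =
      (2 * Real.pi) ^ (-(Fintype.card ι / 2 : ℝ)) * Real.exp (-(1 / 2) * ‖x‖ ^ 2) := by
  rw [logDensity_one, sub_eq_add_neg, Real.exp_add, Real.rpow_def_of_pos (by positivity)]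
  congr 2 <;> ring

lemma integrable_exp_logDensity_one :
    Integrable (fun x : EuclideanSpace ℝ ι => Real.exp (logDensity 1 x)) := by
  simp_rw [exp_logDensity_one]
  refine Integrable.const_mul ?_ _
  have h := GaussianFourier.integral_rexp_neg_mul_sq_norm (V := EuclideanSpace ℝ ι)
    (b := 1 / 2) (by norm_num)
  -- The Bochner integral of a non-integrable function is 0, whereas the Gaussian integral is
  -- positive.
  by_contra hc
  rw [integral_undef hc] at h
  exact absurd h (by positivity)

/-- Both sides are finite measures with the same characteristic function: the Fourier transform of
the density is the Gaussian integral with parameter 1/2. -/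
lemma stdGaussian_eq_withDensity :
    stdGaussian (EuclideanSpace ℝ ι) =
      volume.withDensity fun x => ENNReal.ofReal (Real.exp (logDensity 1 x)) := by
  have : IsFiniteMeasure ((volume : Measure (EuclideanSpace ℝ ι)).withDensity
      fun x => ENNReal.ofReal (Real.exp (logDensity 1 x))) :=
    isFiniteMeasure_withDensity_ofReal integrable_exp_logDensity_one.2
  apply Measure.ext_of_charFun
  ext t
  rw [charFun_stdGaussian, charFun_apply,
    integral_withDensity_eq_integral_toReal_smul (by fun_prop) (by simp)]
  have h := GaussianFourier.integral_cexp_neg_mul_sq_norm_add (V := EuclideanSpace ℝ ι)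
    (b := 1 / 2) (by norm_num) Complex.I t
  have h2 : ∀ x : EuclideanSpace ℝ ι,
      (ENNReal.ofReal (Real.exp (logDensity 1 x))).toReal • Complex.exp (⟪x, t⟫ * Complex.I)
      = ((2 * Real.pi) ^ (-(Fintype.card ι / 2 : ℝ)) : ℝ) *
        Complex.exp (-(1 / 2) * ‖x‖ ^ 2 + Complex.I * ⟪t, x⟫) := by
    intro x
    rw [ENNReal.toReal_ofReal (by positivity), exp_logDensity_one, Complex.exp_add,
      real_inner_comm x t, Complex.real_smul]
    push_cast
    rw [mul_comm Complex.I]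
    ring
  simp_rw [h2]
  rw [integral_const_mul, h]
  have h3 : ((Real.pi : ℂ) / (1 / 2)) ^ ((Module.finrank ℝ (EuclideanSpace ℝ ι) : ℂ) / 2)
      = (((2 * Real.pi) ^ (Fintype.card ι / 2 : ℝ) : ℝ) : ℂ) := by
    rw [Complex.ofReal_cpow (by positivity)]
    simp [mul_comm]
  rw [h3, ← mul_assoc, ← Complex.ofReal_mul, ← Real.rpow_add (by positivity)]
  simp
  ring_nf

/-- Change of variables, since T scales Haar measure by |det T|⁻¹. The relation `hgh` between the
densities is phrased so that T⁻¹ never appears. -/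
lemma map_linear_withDensity {E : Type*} [NormedAddCommGroup E] [NormedSpace ℝ E]
    [FiniteDimensional ℝ E] [MeasurableSpace E] [BorelSpace E] (μ : Measure E)
    [μ.IsAddHaarMeasure] (T : E →ₗ[ℝ] E) (hT : LinearMap.det T ≠ 0) (g h : E → ℝ≥0∞)
    (hh : Measurable h)
    (hgh : ∀ x, g x = ENNReal.ofReal |LinearMap.det T| * h (T x)) :
    (μ.withDensity g).map T = μ.withDensity h := by
  have hTm : Measurable T := T.continuous_of_finiteDimensional.measurable
  ext s hs
  rw [Measure.map_apply hTm hs, withDensity_apply _ (hTm hs), withDensity_apply _ hs]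
  have h1 := Measure.map_linearMap_addHaar_eq_smul_addHaar μ hT
  have h2 : μ = ENNReal.ofReal |LinearMap.det T| • Measure.map T μ := by
    rw [h1, smul_smul, ← ENNReal.ofReal_mul (abs_nonneg _), ← abs_mul, mul_inv_cancel₀ hT]
    simp
  conv_rhs => rw [h2]
  rw [Measure.restrict_smul, lintegral_smul_measure, setLIntegral_map hs hh hTm]
  simp_rw [hgh]
  rw [lintegral_const_mul _ (by fun_prop), smul_eq_mul]

/-- The law is the image of the standard Gaussian under R = √S. The identity R S⁻¹ R = 1 turns the
quadratic form into the squared norm, and (det R)² = det S accounts for the normalization. -/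
theorem multivariateGaussian_eq_withDensity {S : Matrix ι ι ℝ} (hS : S.PosDef) :
    multivariateGaussian 0 S =
      volume.withDensity fun x => ENNReal.ofReal (Real.exp (logDensity S x)) := by
  set R := CFC.sqrt S with hR
  have hRR : R * R = S := CFC.sqrt_mul_sqrt_self _ hS.posSemidef.nonneg
  have hRs : Rᵀ = R := by
    have h : IsSelfAdjoint R := (CFC.sqrt_nonneg S).isSelfAdjoint
    have := h.star_eq
    rwa [Matrix.star_eq_conjTranspose, Matrix.conjTranspose_eq_transpose_of_trivial] at this
  have hdet : R.det * R.det = S.det := by rw [← Matrix.det_mul, hRR]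
  have hR0 : R.det ≠ 0 := by
    intro h0
    rw [h0] at hdet
    exact hS.det_pos.ne (by simpa using hdet)
  have hRu : IsUnit R.det := hR0.isUnit
  have hdetT : LinearMap.det (Matrix.toEuclideanCLM (𝕜 := ℝ) R :
      EuclideanSpace ℝ ι →ₗ[ℝ] EuclideanSpace ℝ ι) = R.det := by
    rw [Matrix.coe_toEuclideanCLM_eq_toEuclideanLin]
    exact LinearMap.det_toLpLin _ _
  rw [multivariateGaussian, stdGaussian_eq_withDensity]
  simp only [zero_add]
  refine map_linear_withDensity volume (Matrix.toEuclideanCLM (𝕜 := ℝ) R :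
      EuclideanSpace ℝ ι →ₗ[ℝ] EuclideanSpace ℝ ι) (by rwa [hdetT]) _ _ (by fun_prop) ?_
  intro x
  rw [hdetT, ← ENNReal.ofReal_mul (abs_nonneg _)]
  congr 1
  nth_rw 1 [← Real.exp_log (abs_pos.2 hR0)]
  rw [← Real.exp_add]
  congr 1
  have hq : quadForm S⁻¹ (Matrix.toEuclideanCLM (𝕜 := ℝ) R x) = quadForm 1⁻¹ x := by
    have h1 : R * S⁻¹ * R = 1 := by
      rw [← hRR, Matrix.mul_inv_rev, ← mul_assoc, Matrix.mul_nonsing_inv _ hRu, one_mul,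
        Matrix.nonsing_inv_mul _ hRu]
    simp only [quadForm, Matrix.ofLp_toEuclideanCLM, inv_one]
    rw [← h1, ← Matrix.mulVec_mulVec, ← Matrix.mulVec_mulVec]
    rw [Matrix.dotProduct_mulVec x.ofLp R, ← Matrix.mulVec_transpose, hRs]
  simp only [logDensity, ContinuousLinearMap.coe_coe]
  rw [hq, ← hdet, Real.log_mul hR0 hR0, Real.log_abs]
  simp
  ring

end GaussianDensity

/-! ### Second moments and least squares estimation. -/

section Moments

open scoped RealInnerProductSpace

variable {Ω ι : Type*} [MeasurableSpace Ω] [Fintype ι]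

/-- Row i holds coefficients of the projection of `x i` onto the span of the `y k`. They need not be
unique, so the `y k` may be dependent and no covariance matrix has to be inverted. -/
lemma exists_coeff_inner_sub_eq_zero {H : Type*} [NormedAddCommGroup H] [InnerProductSpace ℝ H]
    (x y : ι → H) :
    ∃ K : Matrix ι ι ℝ, ∀ i j, ⟪x i - ∑ k, K i k • y k, y j⟫ = 0 := by
  let W := Submodule.span ℝ (Set.range y)
  have : FiniteDimensional ℝ W := FiniteDimensional.span_of_finite ℝ (Set.finite_range y)
  have h : ∀ i, ∃ c : ι → ℝ, ∑ k, c k • y k = W.starProjection (x i) := fun i =>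
    Submodule.mem_span_range_iff_exists_fun ℝ |>.1 (W.starProjection_apply_mem (x i))
  choose K hK using h
  refine ⟨K, fun i j => ?_⟩
  rw [hK]
  exact Submodule.starProjection_inner_eq_zero (K := W) (x i) (y j)
    (Submodule.subset_span ⟨j, rfl⟩)

/-- The matrix of second moments of a family of random variables. -/
noncomputable def secondMoment (π : Measure Ω) (r : ι → Ω → ℝ) : Matrix ι ι ℝ :=
  Matrix.of fun i j => ∫ z, r i z * r j z ∂π

variable {π : Measure Ω}

lemma exists_linear_estimator {x y : ι → Ω → ℝ} (hx : ∀ i, MemLp (x i) 2 π)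
    (hy : ∀ i, MemLp (y i) 2 π) :
    ∃ K : Matrix ι ι ℝ, ∀ i j, ∫ z, (x i z - ∑ k, K i k * y k z) * y j z ∂π = 0 := by
  obtain ⟨K, hK⟩ := exists_coeff_inner_sub_eq_zero (fun i => (hx i).toLp) (fun i => (hy i).toLp)
  refine ⟨K, fun i j => ?_⟩
  have key : ∀ {f g : Ω → ℝ} (hf : MemLp f 2 π) (hg : MemLp g 2 π),
      ⟪hf.toLp, hg.toLp⟫ = ∫ z, f z * g z ∂π := by
    intro f g hf hg
    rw [L2.inner_def]
    refine integral_congr_ae ?_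
    filter_upwards [hf.coeFn_toLp, hg.coeFn_toLp] with z h1 h2
    rw [h1, h2]
    simp [mul_comm]
  have h := hK i j
  rw [inner_sub_left, sum_inner] at h
  simp_rw [real_inner_smul_left, key] at h
  have i1 : ∀ k, Integrable (fun z => K i k * (y k z * y j z)) π := fun k =>
    ((hy k).integrable_mul (hy j)).const_mul _
  simp_rw [sub_mul, Finset.sum_mul, mul_assoc]
  have i0 : Integrable (fun z => x i z * y j z) π := (hx i).integrable_mul (hy j)
  rw [integral_sub i0 (integrable_finsetSum _ fun k _ => i1 k),
    integral_finsetSum _ fun k _ => i1 k]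
  simp_rw [integral_const_mul]
  exact h

lemma secondMoment_quadratic {r : ι → Ω → ℝ} (hr : ∀ i, MemLp (r i) 2 π) (A : Matrix ι ι ℝ) :
    Integrable (fun z => ∑ i, ∑ j, A i j * (r i z * r j z)) π ∧
      ∫ z, ∑ i, ∑ j, A i j * (r i z * r j z) ∂π = ∑ i, ∑ j, A i j * secondMoment π r i j := by
  have h : ∀ i j, Integrable (fun z => A i j * (r i z * r j z)) π := fun i j =>
    ((hr i).integrable_mul (hr j)).const_mul _
  refine ⟨integrable_finsetSum _ fun i _ => integrable_finsetSum _ fun j _ => h i j, ?_⟩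
  rw [integral_finsetSum _ fun i _ => integrable_finsetSum _ fun j _ => h i j]
  refine Finset.sum_congr rfl fun i _ => ?_
  rw [integral_finsetSum _ fun j _ => h i j]
  exact Finset.sum_congr rfl fun j _ => integral_const_mul _ _

lemma secondMoment_posSemidef {r : ι → Ω → ℝ} (hr : ∀ i, MemLp (r i) 2 π) :
    (secondMoment π r).PosSemidef := by
  refine Matrix.PosSemidef.of_dotProduct_mulVec_nonneg
    (by ext i j; simp [secondMoment, mul_comm]) fun v => ?_
  have h := (secondMoment_quadratic hr (Matrix.of fun i j => v i * v j)).2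
  have e : star v ⬝ᵥ secondMoment π r *ᵥ v =
      ∑ i, ∑ j, Matrix.of (fun i j => v i * v j) i j * secondMoment π r i j := by
    simp only [dotProduct, Matrix.mulVec, Finset.mul_sum, Matrix.of_apply, star_trivial]
    exact Finset.sum_congr rfl fun i _ => Finset.sum_congr rfl fun j _ => by ring
  rw [e, ← h]
  refine integral_nonneg fun z => ?_
  have : ∑ i, ∑ j, Matrix.of (fun i j => v i * v j) i j * (r i z * r j z) =
      (∑ i, v i * r i z) * ∑ i, v i * r i z := by
    rw [Finset.sum_mul_sum]
    exact Finset.sum_congr rfl fun i _ => Finset.sum_congr rfl fun j _ => by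
      simp only [Matrix.of_apply]; ring
  simp only [Pi.zero_apply]
  rw [this]
  exact mul_self_nonneg _

lemma sum_mul_eq_trace (A : Matrix ι ι ℝ) {M : Matrix ι ι ℝ} (hM : M.IsHermitian) :
    ∑ i, ∑ j, A i j * M i j = (A * M).trace := by
  simp only [Matrix.trace, Matrix.diag, Matrix.mul_apply]
  refine Finset.sum_congr rfl fun i _ => Finset.sum_congr rfl fun j _ => ?_
  rw [← hM.apply i j]
  simp

/-- The least squares linear estimation error: its second moment matrix is below that of the
estimated vector, and it has the least diagonal entries. -/
theorem exists_estimator_secondMoment_le {x y : ι → Ω → ℝ} (hx : ∀ i, MemLp (x i) 2 π)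
    (hy : ∀ i, MemLp (y i) 2 π) :
    ∃ K : Matrix ι ι ℝ,
      (∀ i, MemLp (fun z => x i z - ∑ k, K i k * y k z) 2 π) ∧
      (secondMoment π x - secondMoment π fun i z => x i z - ∑ k, K i k * y k z).PosSemidef ∧
      ∀ i, secondMoment π (fun i z => x i z - ∑ k, K i k * y k z) i i ≤
        ∫ z, (x i z - y i z) ^ 2 ∂π := by
  obtain ⟨K, hK⟩ := exists_linear_estimator hx hy
  set r : ι → Ω → ℝ := fun i z => x i z - ∑ k, K i k * y k z with hr
  set w : ι → Ω → ℝ := fun i z => ∑ k, K i k * y k z with hw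
  have hwm : ∀ i, MemLp (w i) 2 π := fun i => memLp_finsetSum _ fun k _ => (hy k).const_mul _
  have hrm : ∀ i, MemLp (r i) 2 π := fun i => (hx i).sub (hwm i)
  have hrw : ∀ i j, ∫ z, r i z * w j z ∂π = 0 := by
    intro i j
    simp only [hw, Finset.mul_sum]
    rw [integral_finsetSum]
    · refine Finset.sum_eq_zero fun k _ => ?_
      simp_rw [mul_left_comm (r i _)]
      rw [integral_const_mul, hK i k, mul_zero]
    · intro k _
      exact (hrm i).integrable_mul ((hy k).const_mul _)
  have hxr : ∀ i z, x i z = r i z + w i z := fun i z => by simp [hr, hw]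
  refine ⟨K, hrm, ?_, fun i => ?_⟩
  -- In x = r + w the cross moments vanish, so the difference is the second moment matrix of w.
  · have : secondMoment π x - secondMoment π r = secondMoment π w := by
      ext i j
      simp only [secondMoment, Matrix.sub_apply, Matrix.of_apply]
      have e : ∀ z, x i z * x j z =
          (r i z * r j z + w i z * w j z) + (r i z * w j z + r j z * w i z) := by
        intro z; rw [hxr i, hxr j]; ring
      simp_rw [e]
      rw [integral_add, integral_add, integral_add, hrw, hrw]
      · ring
      all_goals first
        | exact (hrm _).integrable_mul (hwm _)
        | exact (hrm _).integrable_mul (hrm _)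
        | exact (hwm _).integrable_mul (hwm _)
        | exact ((hrm _).integrable_mul (hrm _)).add ((hwm _).integrable_mul (hwm _))
        | exact ((hrm _).integrable_mul (hwm _)).add ((hrm _).integrable_mul (hwm _))
    rw [this]
    exact secondMoment_posSemidef hwm
  · have hd : MemLp (fun z => w i z - y i z) 2 π := (hwm i).sub (hy i)
    -- Pythagoras for x − y = r + (w − y): the error r is orthogonal to both w and y.
    have e : ∀ z, (x i z - y i z) ^ 2 =
        r i z * r i z + (w i z - y i z) ^ 2 + 2 * (r i z * w i z - r i z * y i z) := by
      intro z; rw [hxr i]; ring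
    have i1 : Integrable (fun z => r i z * r i z) π := (hrm i).integrable_mul (hrm i)
    have i2 : Integrable (fun z => r i z * w i z) π := (hrm i).integrable_mul (hwm i)
    have i3 : Integrable (fun z => r i z * y i z) π := (hrm i).integrable_mul (hy i)
    have i4 : Integrable (fun z => (w i z - y i z) ^ 2) π := hd.integrable_sq
    have hry : ∫ z, r i z * y i z ∂π = 0 := hK i i
    have s1 : ∫ z, (x i z - y i z) ^ 2 ∂π =
        ∫ z, r i z * r i z ∂π + ∫ z, (w i z - y i z) ^ 2 ∂π := by
      simp_rw [e]
      have i5 : Integrable (fun z => 2 * (r i z * w i z - r i z * y i z)) π :=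
        (i2.sub i3).const_mul 2
      have i6 : Integrable (fun z => r i z * r i z + (w i z - y i z) ^ 2) π := i1.add i4
      rw [integral_add i6 i5, integral_add i1 i4, integral_const_mul, integral_sub i2 i3, hrw, hry]
      ring
    rw [s1]
    have : 0 ≤ ∫ z, (w i z - y i z) ^ 2 ∂π := integral_nonneg fun z => sq_nonneg _
    simp only [secondMoment, Matrix.of_apply]
    linarith

end Moments

/-! ### A variational lower bound for divergence. -/

section DonskerVaradhan

variable {Ω : Type*} [MeasurableSpace Ω]

/-- Since exp f has mass one under ρ, tilting ρ by f gives a probability measure with density exp f.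
The claim is the nonnegativity of the divergence of π from that tilted measure. -/
theorem integral_le_toReal_klDiv {π ρ : Measure Ω} [IsProbabilityMeasure π]
    [IsProbabilityMeasure ρ] (hkl : klDiv π ρ ≠ ∞) {f : Ω → ℝ} (hf : Integrable f π)
    (hfm : Measurable f) (h1 : ∫⁻ z, ENNReal.ofReal (Real.exp (f z)) ∂ρ = 1) :
    ∫ z, f z ∂π ≤ (klDiv π ρ).toReal := by
  obtain ⟨hac, hint⟩ := klDiv_ne_top_iff.1 hkl
  have he : Integrable (fun z => Real.exp (f z)) ρ := by
    refine ⟨by fun_prop, ?_⟩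
    rw [hasFiniteIntegral_iff_ofReal (Filter.Eventually.of_forall fun z => (Real.exp_pos _).le), h1]
    exact ENNReal.one_lt_top
  have h1' : ∫ z, Real.exp (f z) ∂ρ = 1 := by
    rw [integral_eq_lintegral_of_nonneg_ae
      (Filter.Eventually.of_forall fun z => (Real.exp_pos _).le) (by fun_prop), h1]
    rfl
  have : IsProbabilityMeasure (ρ.tilted f) := isProbabilityMeasure_tilted he
  have h := integral_llr_add_sub_measure_univ_nonneg
    (hac.trans (absolutelyContinuous_tilted he)) (integrable_llr_tilted_right hac hf hint he)
  rw [integral_llr_tilted_right hac hf he hint, h1', Real.log_one] at h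
  rw [toReal_klDiv_of_measure_eq hac (by simp)]
  simp at h
  linarith

end DonskerVaradhan

/-! ### Converse and achievability through the backward channel. -/

section GaussianChannel

open scoped MatrixOrder

variable {Ω ι : Type*} [MeasurableSpace Ω] [Fintype ι] [DecidableEq ι]

lemma secondMoment_of_map_eq_multivariateGaussian {π : Measure Ω} {φ : Ω → EuclideanSpace ℝ ι}
    (hφ : AEMeasurable φ π) {S : Matrix ι ι ℝ} (hS : S.PosSemidef)
    (h : π.map φ = multivariateGaussian 0 S) :
    (∀ i, MemLp (fun z => φ z i) 2 π) ∧ secondMoment π (fun i z => φ z i) = S := by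
  have hm : ∀ i, MemLp (fun x : EuclideanSpace ℝ ι => x i) 2 (multivariateGaussian 0 S) := by
    intro i
    exact (EuclideanSpace.proj (𝕜 := ℝ) i).comp_memLp' IsGaussian.memLp_two_id
  have h0 : ∀ i, ∫ x : EuclideanSpace ℝ ι, x i ∂multivariateGaussian 0 S = 0 := by
    intro i
    have := (EuclideanSpace.proj (𝕜 := ℝ) i).integral_comp_comm
      (IsGaussian.integrable_id (μ := multivariateGaussian 0 S))
    simp only [id_eq, integral_id_multivariateGaussian] at this
    simpa using this
  constructor
  · intro i
    have := hm i
    rw [← h] at this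
    exact this.comp_of_map hφ
  · ext i j
    have hc := covariance_eval_multivariateGaussian (μ := 0) hS i j
    rw [covariance, h0, h0, ← h, integral_map hφ (by fun_prop)] at hc
    simpa [secondMoment] using hc

lemma integral_logDensity {π : Measure Ω} [IsProbabilityMeasure π] {r : Ω → EuclideanSpace ℝ ι}
    (hr : ∀ i, MemLp (fun z => r z i) 2 π) (T : Matrix ι ι ℝ) :
    Integrable (fun z => logDensity T (r z)) π ∧
      ∫ z, logDensity T (r z) ∂π =
        -(Fintype.card ι / 2 * Real.log (2 * Real.pi)) - 1 / 2 * Real.log T.det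
          - 1 / 2 * (T⁻¹ * secondMoment π fun i z => r z i).trace := by
  obtain ⟨h1, h2⟩ := secondMoment_quadratic hr T⁻¹
  have h3 : Integrable (fun z => 1 / 2 * quadForm T⁻¹ (r z)) π := by
    simp_rw [quadForm_eq_sum]
    exact h1.const_mul _
  refine ⟨(integrable_const _).sub h3, ?_⟩
  unfold logDensity
  rw [integral_sub (integrable_const _) h3, integral_const_mul]
  simp_rw [quadForm_eq_sum]
  rw [h2, sum_mul_eq_trace _ (secondMoment_posSemidef hr).1]
  simp

/-- The log-likelihood ratio, relative to the source law with covariance `Q`, of the backward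
channel `x = K y + n` with noise covariance `T`. -/
noncomputable def channelLogLik (Q T K : Matrix ι ι ℝ)
    (z : EuclideanSpace ℝ ι × EuclideanSpace ℝ ι) : ℝ :=
  logDensity T (z.1 - Matrix.toEuclideanCLM (𝕜 := ℝ) K z.2) - logDensity Q z.1

lemma measurable_channelLogLik (Q T K : Matrix ι ι ℝ) : Measurable (channelLogLik Q T K) := by
  unfold channelLogLik
  fun_prop

/-- For fixed y the density of N(0, Q) cancels, leaving the density of N(0, T) translated by K y.
Since ν is arbitrary, the same identity serves the converse, as a normalization, and achievability,
as a formula for the joint law. -/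
lemma withDensity_channelLogLik {Q T : Matrix ι ι ℝ} (hQ : Q.PosDef) (hT : T.PosDef)
    (K : Matrix ι ι ℝ) (ν : Measure (EuclideanSpace ℝ ι)) [IsProbabilityMeasure ν] :
    ((multivariateGaussian 0 Q).prod ν).withDensity
        (fun z => ENNReal.ofReal (Real.exp (channelLogLik Q T K z))) =
      ((multivariateGaussian 0 T).prod ν).map
        fun z => (z.1 + Matrix.toEuclideanCLM (𝕜 := ℝ) K z.2, z.2) := by
  have hm := measurable_channelLogLik Q T K
  refine Measure.ext_of_lintegral _ fun g hg => ?_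
  rw [lintegral_withDensity_eq_lintegral_mul _ (by fun_prop) hg, lintegral_map hg (by fun_prop),
    lintegral_prod_symm _ (by fun_prop), lintegral_prod_symm _ (by fun_prop)]
  refine lintegral_congr fun y => ?_
  rw [multivariateGaussian_eq_withDensity hQ, multivariateGaussian_eq_withDensity hT,
    lintegral_withDensity_eq_lintegral_mul _ (by fun_prop) (by fun_prop),
    lintegral_withDensity_eq_lintegral_mul _ (by fun_prop) (by fun_prop)]
  rw [← lintegral_add_right_eq_self _ (Matrix.toEuclideanCLM (𝕜 := ℝ) K y)]
  refine lintegral_congr fun x => ?_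
  simp only [Pi.mul_apply, channelLogLik, add_sub_cancel_right]
  rw [← mul_assoc, ← ENNReal.ofReal_mul (by positivity), ← Real.exp_add]
  congr 3
  ring

/-- **Converse.** For a centered Gaussian source, some error covariance below `Q`, with diagonal
bounded by the mean square errors, bounds the mutual information from below. -/
theorem exists_errorCov_le_mutualInfo {Q : Matrix ι ι ℝ} (hQ : Q.PosDef)
    {π : Measure (EuclideanSpace ℝ ι × EuclideanSpace ℝ ι)} [IsProbabilityMeasure π]
    (hπ : π.fst = multivariateGaussian 0 Q)
    (hd : ∀ i, MemLp (fun z => z.1 i - z.2 i) 2 π) (hI : mutualInfo π ≠ ∞) :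
    ∃ S : Matrix ι ι ℝ, S.PosSemidef ∧ (Q - S).PosSemidef ∧
      (∀ i, S i i ≤ ∫ z, (z.1 i - z.2 i) ^ 2 ∂π) ∧ S.det ≠ 0 ∧
      1 / 2 * Real.log (Q.det / S.det) ≤ (mutualInfo π).toReal := by
  obtain ⟨hx, hxQ⟩ := secondMoment_of_map_eq_multivariateGaussian (by fun_prop) hQ.posSemidef hπ
  have hy : ∀ i, MemLp (fun z : EuclideanSpace ℝ ι × EuclideanSpace ℝ ι => z.2 i) 2 π := by
    intro i
    have := (hx i).sub (hd i)
    refine this.ae_eq (Filter.Eventually.of_forall fun z => ?_)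
    simp
  obtain ⟨K, hr, hle, hdiag⟩ := exists_estimator_secondMoment_le hx hy
  rw [hxQ] at hle
  have e : (fun i (z : EuclideanSpace ℝ ι × EuclideanSpace ℝ ι) => z.1 i - ∑ k, K i k * z.2 k) =
      fun i z => (z.1 - Matrix.toEuclideanCLM (𝕜 := ℝ) K z.2) i := by
    ext i z
    simp [Matrix.ofLp_toEuclideanCLM, Matrix.mulVec, dotProduct]
  have hr' : ∀ i, MemLp (fun z : EuclideanSpace ℝ ι × EuclideanSpace ℝ ι =>
      (z.1 - Matrix.toEuclideanCLM (𝕜 := ℝ) K z.2) i) 2 π := by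
    intro i
    rw [← congrFun e i]
    exact hr i
  rw [e] at hle hdiag
  set S := secondMoment π
    (fun i (z : EuclideanSpace ℝ ι × EuclideanSpace ℝ ι) =>
      (z.1 - Matrix.toEuclideanCLM (𝕜 := ℝ) K z.2) i) with hS
  have hSpos : S.PosSemidef := secondMoment_posSemidef hr'
  -- S is not yet known to be nonsingular, so the noise covariance is regularized to S + εI.
  have bound : ∀ ε : ℝ, 0 < ε →
      Real.log Q.det - Real.log (S + ε • 1).det ≤ 2 * (mutualInfo π).toReal := by
    intro ε hε
    have hT : (S + ε • (1 : Matrix ι ι ℝ)).PosDef := by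
      refine Matrix.PosDef.posSemidef_add hSpos ?_
      exact Matrix.PosDef.one.smul hε
    set T := S + ε • (1 : Matrix ι ι ℝ) with hTdef
    have hTu : IsUnit T.det := hT.det_pos.ne'.isUnit
    obtain ⟨i1, v1⟩ := integral_logDensity hr' T
    obtain ⟨i2, v2⟩ := integral_logDensity hx Q
    have h1 : ∫⁻ z, ENNReal.ofReal (Real.exp (channelLogLik Q T K z)) ∂(π.fst.prod π.snd) = 1 := by
      rw [← setLIntegral_univ, ← withDensity_apply _ MeasurableSet.univ, hπ,
        withDensity_channelLogLik hQ hT, Measure.map_apply (by fun_prop) MeasurableSet.univ]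
      simp
    have h := integral_le_toReal_klDiv (π := π) (ρ := π.fst.prod π.snd) hI (i1.sub i2)
      (measurable_channelLogLik Q T K) h1
    simp only [Pi.sub_apply] at h
    rw [integral_sub i1 i2, v1, v2, hxQ, ← hS,
      Matrix.nonsing_inv_mul _ hQ.det_pos.ne'.isUnit] at h
    -- The trace is the dimension minus ε tr T⁻¹, so the error made by regularizing has the
    -- favourable sign.
    have ht : (T⁻¹ * S).trace ≤ Fintype.card ι := by
      have : S = T - ε • 1 := by simp [hTdef]
      rw [this, mul_sub, Matrix.nonsing_inv_mul _ hTu, Matrix.trace_sub, Matrix.trace_one]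
      have : 0 ≤ (T⁻¹).trace := hT.inv.posSemidef.trace_nonneg
      simp only [mul_smul_comm, mul_one, Matrix.trace_smul, smul_eq_mul]
      nlinarith
    rw [Matrix.trace_one] at h
    unfold mutualInfo
    linarith
  -- In exponential form the bound passes to the limit ε → 0 even before det S ≠ 0 is known, and
  -- then implies det S > 0.
  have hdet : Q.det * Real.exp (-(2 * (mutualInfo π).toReal)) ≤ S.det := by
    have hc : Filter.Tendsto (fun ε : ℝ => (S + ε • (1 : Matrix ι ι ℝ)).det)
        (nhdsWithin 0 (Set.Ioi 0)) (nhds S.det) := by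
      have : Continuous fun ε : ℝ => (S + ε • (1 : Matrix ι ι ℝ)).det := by fun_prop
      simpa using (this.tendsto 0).mono_left nhdsWithin_le_nhds
    refine ge_of_tendsto hc ?_
    filter_upwards [self_mem_nhdsWithin] with ε hε
    have hT : (S + ε • (1 : Matrix ι ι ℝ)).PosDef :=
      Matrix.PosDef.posSemidef_add hSpos (Matrix.PosDef.one.smul hε)
    rw [← Real.exp_log hQ.det_pos, ← Real.exp_add, ← Real.le_log_iff_exp_le hT.det_pos]
    linarith [bound ε hε]
  have hSd : 0 < S.det := lt_of_lt_of_le (mul_pos hQ.det_pos (Real.exp_pos _)) hdet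
  refine ⟨S, hSpos, hle, hdiag, hSd.ne', ?_⟩
  have := Real.log_le_log (mul_pos hQ.det_pos (Real.exp_pos _)) hdet
  rw [Real.log_mul hQ.det_pos.ne' (Real.exp_pos _).ne', Real.log_exp] at this
  rw [Real.log_div hQ.det_pos.ne' hSd.ne']
  linarith

/-- The log-likelihood ratio is f itself. The sign of the integral is recorded because
`ENNReal.ofReal` would truncate a negative value. -/
lemma klDiv_withDensity_exp {ρ : Measure Ω} [IsProbabilityMeasure ρ] {f : Ω → ℝ}
    (hf : Measurable f)
    [IsProbabilityMeasure (ρ.withDensity fun z => ENNReal.ofReal (Real.exp (f z)))]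
    (hint : Integrable f (ρ.withDensity fun z => ENNReal.ofReal (Real.exp (f z)))) :
    0 ≤ ∫ z, f z ∂(ρ.withDensity fun z => ENNReal.ofReal (Real.exp (f z))) ∧
    klDiv (ρ.withDensity fun z => ENNReal.ofReal (Real.exp (f z))) ρ =
      ENNReal.ofReal (∫ z, f z ∂(ρ.withDensity fun z => ENNReal.ofReal (Real.exp (f z)))) := by
  set π := ρ.withDensity fun z => ENNReal.ofReal (Real.exp (f z)) with hπ
  have hac : π ≪ ρ := withDensity_absolutelyContinuous _ _
  have hl : llr π ρ =ᵐ[π] f := by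
    have := Measure.rnDeriv_withDensity ρ
      (f := fun z => ENNReal.ofReal (Real.exp (f z))) (by fun_prop)
    filter_upwards [hac.ae_le this] with z hz
    rw [llr, hz, ENNReal.toReal_ofReal (Real.exp_pos _).le, Real.log_exp]
  have h0 := integral_llr_add_sub_measure_univ_nonneg hac (hint.congr hl.symm)
  rw [integral_congr_ae hl] at h0
  rw [klDiv_of_ac_of_integrable hac (hint.congr hl.symm), integral_congr_ae hl]
  exact ⟨by simpa using h0, by simp⟩

lemma multivariateGaussian_conv {S T : Matrix ι ι ℝ} (hS : S.PosSemidef) (hT : T.PosSemidef) :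
    (multivariateGaussian 0 S).conv (multivariateGaussian 0 T) =
      multivariateGaussian 0 (S + T) := by
  apply Measure.ext_of_charFun
  ext t
  rw [charFun_conv, charFun_multivariateGaussian hS, charFun_multivariateGaussian hT,
    charFun_multivariateGaussian (hS.add hT), ← Complex.exp_add, Matrix.add_mulVec,
    dotProduct_add]
  congr 1
  push_cast
  simp
  ring

/-- **Achievability.** Every nonsingular error covariance below `Q` is realized by a Gaussian
backward channel. -/
theorem exists_law_of_errorCov {Q S : Matrix ι ι ℝ} (hQ : Q.PosDef) (hS : S.PosDef)
    (hQS : (Q - S).PosSemidef) :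
    ∃ π : Measure (EuclideanSpace ℝ ι × EuclideanSpace ℝ ι), IsProbabilityMeasure π ∧
      π.fst = multivariateGaussian 0 Q ∧
      π.map (fun z => z.1 - z.2) = multivariateGaussian 0 S ∧
      0 ≤ 1 / 2 * Real.log (Q.det / S.det) ∧
      mutualInfo π = ENNReal.ofReal (1 / 2 * Real.log (Q.det / S.det)) := by
  set ν := multivariateGaussian (0 : EuclideanSpace ℝ ι) (Q - S) with hν
  set π := ((multivariateGaussian 0 S).prod ν).map
    (fun z : EuclideanSpace ℝ ι × EuclideanSpace ℝ ι =>
      (z.1 + Matrix.toEuclideanCLM (𝕜 := ℝ) 1 z.2, z.2)) with hπ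
  have hp : IsProbabilityMeasure π := Measure.isProbabilityMeasure_map (by fun_prop)
  have hfst : π.fst = multivariateGaussian 0 Q := by
    rw [Measure.fst, hπ, Measure.map_map (by fun_prop) (by fun_prop)]
    have := multivariateGaussian_conv hS.posSemidef hQS
    rw [add_sub_cancel, Measure.conv] at this
    rw [← this]
    congr 1
    ext z
    simp
  have hsnd : π.snd = ν := by
    rw [Measure.snd, hπ, Measure.map_map (by fun_prop) (by fun_prop)]
    exact Measure.snd_prod
  have hdiff : π.map (fun z => z.1 - z.2) = multivariateGaussian 0 S := by
    rw [hπ, Measure.map_map (by fun_prop) (by fun_prop)]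
    have : ((fun z : EuclideanSpace ℝ ι × EuclideanSpace ℝ ι => z.1 - z.2) ∘
        fun z => (z.1 + Matrix.toEuclideanCLM (𝕜 := ℝ) 1 z.2, z.2)) = Prod.fst := by
      ext z
      simp
    rw [this]
    exact Measure.fst_prod
  refine ⟨π, hp, hfst, hdiff, ?_⟩
  -- As the marginals of π are N(0, Q) and ν, the reference measure of the density is the one in the
  -- definition of mutual information.
  have hw : π = (π.fst.prod π.snd).withDensity
      fun z => ENNReal.ofReal (Real.exp (channelLogLik Q S 1 z)) := by
    rw [hfst, hsnd, withDensity_channelLogLik hQ hS]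
  obtain ⟨hx, hxQ⟩ := secondMoment_of_map_eq_multivariateGaussian (by fun_prop) hQ.posSemidef hfst
  obtain ⟨hr, hrS⟩ := secondMoment_of_map_eq_multivariateGaussian (by fun_prop) hS.posSemidef hdiff
  obtain ⟨i1, v1⟩ := integral_logDensity hr S
  obtain ⟨i2, v2⟩ := integral_logDensity hx Q
  have hc : channelLogLik Q S 1 = fun z => logDensity S (z.1 - z.2) - logDensity Q z.1 := by
    ext z
    simp [channelLogLik]
  have hi : Integrable (channelLogLik Q S 1) π := by
    rw [hc]
    exact i1.sub i2
  -- Both trace terms equal the dimension and cancel.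
  have hv : ∫ z, channelLogLik Q S 1 z ∂π = 1 / 2 * Real.log (Q.det / S.det) := by
    rw [hc, integral_sub i1 i2, v1, v2, hxQ, hrS, Matrix.nonsing_inv_mul _ hQ.det_pos.ne'.isUnit,
      Matrix.nonsing_inv_mul _ hS.det_pos.ne'.isUnit, Real.log_div hQ.det_pos.ne' hS.det_pos.ne']
    ring
  have hp' := hp
  rw [hw] at hp' hi
  have hk := klDiv_withDensity_exp (measurable_channelLogLik Q S 1) hi
  rw [← hw, hv] at hk
  exact hk

end GaussianChannel

/-! ### From pairs of vectors to stacked vectors and back. -/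

section Transfer

lemma fst_map_prodMap {A B A' B' : Type*} [MeasurableSpace A] [MeasurableSpace B]
    [MeasurableSpace A'] [MeasurableSpace B'] (π : Measure (A × B))
    {f : A → A'} {g : B → B'} (hf : Measurable f) (hg : Measurable g) :
    (π.map (Prod.map f g)).fst = π.fst.map f := by
  rw [Measure.fst, Measure.fst, Measure.map_map measurable_fst (hf.prodMap hg),
    Measure.map_map hf measurable_fst]
  rfl

/-- Data processing: `Prod.map f g` sends the product of the marginals to the product of the image
marginals. Applied to stacking in the converse and to unstacking in achievability. -/
lemma mutualInfo_map_le {A B A' B' : Type*} [MeasurableSpace A] [MeasurableSpace B]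
    [MeasurableSpace A'] [MeasurableSpace B'] (π : Measure (A × B)) [IsProbabilityMeasure π]
    {f : A → A'} {g : B → B'} (hf : Measurable f) (hg : Measurable g) :
    mutualInfo (π.map (Prod.map f g)) ≤ mutualInfo π := by
  have h1 := fst_map_prodMap π hf hg
  have h2 : (π.map (Prod.map f g)).snd = π.snd.map g := by
    rw [Measure.snd, Measure.snd, Measure.map_map measurable_snd (hf.prodMap hg),
      Measure.map_map hg measurable_snd]
    rfl
  rw [mutualInfo, mutualInfo, h1, h2, Measure.map_prod_map _ _ hf hg]
  exact klDiv_map_le _ _ (hf.prodMap hg)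

variable {Ω : Type*} [MeasurableSpace Ω] {p₁ p₂ : ℕ}

/-- The vectors `x` and `y` from `(xᵀ, yᵀ)ᵀ`. -/
noncomputable def unstack (v : EuclideanSpace ℝ (Fin p₁ ⊕ Fin p₂)) :
    EuclideanSpace ℝ (Fin p₁) × EuclideanSpace ℝ (Fin p₂) :=
  (WithLp.toLp 2 fun i => v (Sum.inl i), WithLp.toLp 2 fun j => v (Sum.inr j))

lemma measurable_unstack :
    Measurable (unstack : EuclideanSpace ℝ (Fin p₁ ⊕ Fin p₂) → _) := by
  unfold unstack
  fun_prop

lemma measurable_stack :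
    Measurable fun z : EuclideanSpace ℝ (Fin p₁) × EuclideanSpace ℝ (Fin p₂) =>
      stack z.1 z.2 := by
  unfold stack
  refine (WithLp.measurable_toLp 2 _).comp (measurable_pi_iff.2 fun i => ?_)
  rcases i with i | i <;> simp only [Sum.elim_inl, Sum.elim_inr] <;> fun_prop

@[fun_prop]
lemma measurable_sqDist {p : ℕ} {x y : Ω → EuclideanSpace ℝ (Fin p)} (hx : Measurable x)
    (hy : Measurable y) : Measurable fun z => sqDist (x z) (y z) := by
  unfold sqDist
  fun_prop

lemma lintegral_sqDist {π : Measure Ω} {p : ℕ} {x y : Ω → EuclideanSpace ℝ (Fin p)}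
    (hx : Measurable x) (hy : Measurable y) :
    ∫⁻ z, (sqDist (x z) (y z) : ℝ≥0∞) ∂π =
      ∑ i, ∫⁻ z, ENNReal.ofReal ((x z i - y z i) ^ 2) ∂π := by
  rw [← lintegral_finsetSum _ fun i _ => by fun_prop]
  refine lintegral_congr fun z => ?_
  rw [← ENNReal.ofReal_sum_of_nonneg fun i _ => sq_nonneg _, ← ENNReal.ofReal_coe_nnreal]
  congr 1
  rw [sqDist, NNReal.coe_pow, coe_nnnorm, EuclideanSpace.real_norm_sq_eq]
  rfl

lemma memLp_two_of_lintegral_sqDist_le {π : Measure Ω} {p : ℕ}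
    {x y : Ω → EuclideanSpace ℝ (Fin p)} (hx : Measurable x) (hy : Measurable y) {Δ : ℝ≥0}
    (h : ∫⁻ z, (sqDist (x z) (y z) : ℝ≥0∞) ∂π ≤ Δ) :
    (∀ i, MemLp (fun z => x z i - y z i) 2 π) ∧
      ∑ i, ∫ z, (x z i - y z i) ^ 2 ∂π ≤ Δ := by
  rw [lintegral_sqDist hx hy] at h
  have hi : ∀ i, Integrable (fun z => (x z i - y z i) ^ 2) π := by
    intro i
    refine ⟨by fun_prop, ?_⟩
    rw [hasFiniteIntegral_iff_ofReal (Filter.Eventually.of_forall fun z => sq_nonneg _)]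
    exact ((Finset.single_le_sum (fun j _ => zero_le) (Finset.mem_univ i)).trans h).trans_lt
      ENNReal.coe_lt_top
  refine ⟨fun i => (memLp_two_iff_integrable_sq (by fun_prop)).2 (hi i), ?_⟩
  have e : ∀ i, ∫⁻ z, ENNReal.ofReal ((x z i - y z i) ^ 2) ∂π =
      ENNReal.ofReal (∫ z, (x z i - y z i) ^ 2 ∂π) := fun i =>
    (ofReal_integral_eq_lintegral_ofReal (hi i)
      (Filter.Eventually.of_forall fun z => sq_nonneg _)).symm
  simp_rw [e] at h
  rw [← ENNReal.ofReal_sum_of_nonneg fun i _ => integral_nonneg fun z => sq_nonneg _,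
    ← ENNReal.ofReal_coe_nnreal, ENNReal.ofReal_le_ofReal_iff Δ.coe_nonneg] at h
  exact h

lemma lintegral_sqDist_le {π : Measure Ω} {p : ℕ}
    {x y : Ω → EuclideanSpace ℝ (Fin p)} (hx : Measurable x) (hy : Measurable y) {Δ : ℝ≥0}
    (hm : ∀ i, MemLp (fun z => x z i - y z i) 2 π)
    (h : ∑ i, ∫ z, (x z i - y z i) ^ 2 ∂π ≤ Δ) :
    ∫⁻ z, (sqDist (x z) (y z) : ℝ≥0∞) ∂π ≤ Δ := by
  rw [lintegral_sqDist hx hy]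
  have e : ∀ i, ∫⁻ z, ENNReal.ofReal ((x z i - y z i) ^ 2) ∂π =
      ENNReal.ofReal (∫ z, (x z i - y z i) ^ 2 ∂π) := fun i =>
    (ofReal_integral_eq_lintegral_ofReal (hm i).integrable_sq
      (Filter.Eventually.of_forall fun z => sq_nonneg _)).symm
  simp_rw [e]
  rw [← ENNReal.ofReal_sum_of_nonneg fun i _ => integral_nonneg fun z => sq_nonneg _,
    ← ENNReal.ofReal_coe_nnreal, ENNReal.ofReal_le_ofReal_iff Δ.coe_nonneg]
  exact h

variable {Q : Matrix (Fin p₁ ⊕ Fin p₂) (Fin p₁ ⊕ Fin p₂) ℝ}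
  {μ : Measure (EuclideanSpace ℝ (Fin p₁) × EuclideanSpace ℝ (Fin p₂))} {Δ₁ Δ₂ : ℝ≥0}

lemma exists_halfLogDetRatio_le_mutualInfo (hQ : Q.PosDef)
    (hμ : μ.map (fun z => stack z.1 z.2) = multivariateGaussian 0 Q)
    [IsProbabilityMeasure μ] {π} (hπ : π ∈ admissibleLaws μ sqDist sqDist Δ₁ Δ₂)
    (hI : mutualInfo π ≠ ∞) :
    ∃ S ∈ feasibleCov Q Δ₁ Δ₂, halfLogDetRatio Q S ≤ ((mutualInfo π : ℝ≥0∞) : EReal) := by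
  obtain ⟨hfst, h1, h2⟩ := hπ
  -- Admissibility does not mention the total mass; the source marginal fixes it.
  have hp : IsProbabilityMeasure π := by
    constructor
    rw [← Measure.fst_univ, hfst, measure_univ]
  have hst := measurable_stack (p₁ := p₁) (p₂ := p₂)
  set Φ := Prod.map (fun z : EuclideanSpace ℝ (Fin p₁) × EuclideanSpace ℝ (Fin p₂) =>
      stack z.1 z.2) (fun z : EuclideanSpace ℝ (Fin p₁) × EuclideanSpace ℝ (Fin p₂) =>
      stack z.1 z.2) with hΦ
  have hΦm : Measurable Φ := hst.prodMap hst
  have hp' : IsProbabilityMeasure (π.map Φ) :=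
    Measure.isProbabilityMeasure_map hΦm.aemeasurable
  have hle : mutualInfo (π.map Φ) ≤ mutualInfo π := mutualInfo_map_le π hst hst
  have hf' : (π.map Φ).fst = multivariateGaussian 0 Q := by
    rw [← hμ, ← hfst, hΦ, fst_map_prodMap π hst hst]
  obtain ⟨m1, s1⟩ := memLp_two_of_lintegral_sqDist_le (by fun_prop) (by fun_prop) h1
  obtain ⟨m2, s2⟩ := memLp_two_of_lintegral_sqDist_le (by fun_prop) (by fun_prop) h2
  have hd : ∀ i, MemLp (fun z : EuclideanSpace ℝ (Fin p₁ ⊕ Fin p₂) ×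
      EuclideanSpace ℝ (Fin p₁ ⊕ Fin p₂) => z.1 i - z.2 i) 2 (π.map Φ) := by
    intro i
    rw [memLp_map_measure_iff (by fun_prop) hΦm.aemeasurable]
    rcases i with i | i
    · exact m1 i
    · exact m2 i
  obtain ⟨S, hS, hQS, hdiag, hdet, hlog⟩ :=
    exists_errorCov_le_mutualInfo hQ hf' hd (hle.trans_lt hI.lt_top).ne
  have hdiag' : ∀ i, S i i ≤ ∫ z, ((Φ z).1 i - (Φ z).2 i) ^ 2 ∂π := by
    intro i
    rw [← integral_map (φ := Φ) (f := fun z => (z.1 i - z.2 i) ^ 2) hΦm.aemeasurable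
      (by fun_prop)]
    exact hdiag i
  refine ⟨S, ⟨hS, hQS, ?_, ?_⟩, ?_⟩
  · exact (Finset.sum_le_sum fun i _ => hdiag' (Sum.inl i)).trans s1
  · exact (Finset.sum_le_sum fun i _ => hdiag' (Sum.inr i)).trans s2
  · rw [halfLogDetRatio, if_neg hdet, ← EReal.coe_toENNReal (EReal.coe_ennreal_nonneg _),
      EReal.toENNReal_coe, ← EReal.coe_ennreal_toReal hI]
    exact EReal.coe_le_coe_iff.2
      (hlog.trans (ENNReal.toReal_mono hI hle))

lemma jointRDF_le_halfLogDetRatio (hQ : Q.PosDef)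
    (hμ : μ.map (fun z => stack z.1 z.2) = multivariateGaussian 0 Q)
    {S} (hS : S ∈ feasibleCov Q Δ₁ Δ₂) :
    ((jointRDF μ sqDist sqDist Δ₁ Δ₂ : ℝ≥0∞) : EReal) ≤ halfLogDetRatio Q S := by
  obtain ⟨hS0, hQS, t1, t2⟩ := hS
  by_cases hdet : S.det = 0
  · simp [halfLogDetRatio, hdet]
  have hSd : S.PosDef := hS0.posDef_iff_isUnit.2 ((Matrix.isUnit_iff_isUnit_det _).2 (Ne.isUnit hdet))
  obtain ⟨π, hp, hfst, hdiff, h0, hI⟩ := exists_law_of_errorCov hQ hSd hQS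
  have hu := measurable_unstack (p₁ := p₁) (p₂ := p₂)
  have hst := measurable_stack (p₁ := p₁) (p₂ := p₂)
  obtain ⟨hm, hmS⟩ := secondMoment_of_map_eq_multivariateGaussian (by fun_prop) hS0 hdiff
  have hmS' : ∀ i, ∫ z, (z.1 i - z.2 i) ^ 2 ∂π = S i i := by
    intro i
    rw [← congrFun (congrFun hmS i) i]
    simp [secondMoment, sq]
  have hΦm : Measurable (Prod.map (unstack (p₁ := p₁) (p₂ := p₂)) unstack) := hu.prodMap hu
  have hmem : π.map (Prod.map unstack unstack) ∈ admissibleLaws μ sqDist sqDist Δ₁ Δ₂ := by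
    refine ⟨?_, ?_, ?_⟩
    · have : μ = (μ.map fun z => stack z.1 z.2).map unstack := by
        rw [Measure.map_map hu hst]
        exact Measure.map_id.symm
      rw [hμ, ← hfst] at this
      rw [this, fst_map_prodMap π hu hu]
    · have hs : Measurable fun z : (EuclideanSpace ℝ (Fin p₁) × EuclideanSpace ℝ (Fin p₂)) ×
          (EuclideanSpace ℝ (Fin p₁) × EuclideanSpace ℝ (Fin p₂)) =>
          (sqDist z.1.1 z.2.1 : ℝ≥0∞) := by fun_prop
      rw [lintegral_map hs hΦm]
      have hux : Measurable fun z : EuclideanSpace ℝ (Fin p₁ ⊕ Fin p₂) ×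
          EuclideanSpace ℝ (Fin p₁ ⊕ Fin p₂) => (unstack z.1).1 := by fun_prop
      have huy : Measurable fun z : EuclideanSpace ℝ (Fin p₁ ⊕ Fin p₂) ×
          EuclideanSpace ℝ (Fin p₁ ⊕ Fin p₂) => (unstack z.2).1 := by fun_prop
      refine lintegral_sqDist_le hux huy (fun i => hm (Sum.inl i)) ?_
      exact (Finset.sum_congr rfl fun i _ => hmS' (Sum.inl i)).trans_le t1
    · have hs : Measurable fun z : (EuclideanSpace ℝ (Fin p₁) × EuclideanSpace ℝ (Fin p₂)) ×
          (EuclideanSpace ℝ (Fin p₁) × EuclideanSpace ℝ (Fin p₂)) =>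
          (sqDist z.1.2 z.2.2 : ℝ≥0∞) := by fun_prop
      rw [lintegral_map hs hΦm]
      have hux : Measurable fun z : EuclideanSpace ℝ (Fin p₁ ⊕ Fin p₂) ×
          EuclideanSpace ℝ (Fin p₁ ⊕ Fin p₂) => (unstack z.1).2 := by fun_prop
      have huy : Measurable fun z : EuclideanSpace ℝ (Fin p₁ ⊕ Fin p₂) ×
          EuclideanSpace ℝ (Fin p₁ ⊕ Fin p₂) => (unstack z.2).2 := by fun_prop
      refine lintegral_sqDist_le hux huy (fun i => hm (Sum.inr i)) ?_
      exact (Finset.sum_congr rfl fun i _ => hmS' (Sum.inr i)).trans_le t2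
  have h1 : jointRDF μ sqDist sqDist Δ₁ Δ₂ ≤ ENNReal.ofReal (1 / 2 * Real.log (Q.det / S.det)) :=
    (iInf₂_le _ hmem).trans ((mutualInfo_map_le π hu hu).trans hI.le)
  rw [halfLogDetRatio, if_neg hdet]
  refine (EReal.coe_ennreal_le_coe_ennreal_iff.2 h1).trans ?_
  rw [EReal.coe_ennreal_ofReal, max_eq_left h0]

theorem jointRDF_eq_iInf_feasibleCov (hQ : Q.PosDef)
    (hμ : μ.map (fun z => stack z.1 z.2) = multivariateGaussian 0 Q)
    [IsProbabilityMeasure μ] :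
    ((jointRDF μ sqDist sqDist Δ₁ Δ₂ : ℝ≥0∞) : EReal) =
      ⨅ S ∈ feasibleCov Q Δ₁ Δ₂, halfLogDetRatio Q S := by
  refine le_antisymm (le_iInf₂ fun S hS => jointRDF_le_halfLogDetRatio hQ hμ hS) ?_
  -- Bounding the infimum by its positive part moves the comparison to `ℝ≥0∞`, where the rate is an
  -- infimum over laws.
  refine (le_max_right 0 _).trans (EReal.coe_toENNReal_eq_max.symm.le.trans
    (EReal.coe_ennreal_le_coe_ennreal_iff.2 ?_))
  refine le_iInf₂ fun π hπ => ?_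
  by_cases hI : mutualInfo π = ∞
  · rw [hI]; exact le_top
  obtain ⟨S, hS, hle⟩ := exists_halfLogDetRatio_le_mutualInfo hQ hμ hπ hI
  rw [← EReal.toENNReal_coe (x := mutualInfo π)]
  exact EReal.toENNReal_le_toENNReal ((iInf₂_le S hS).trans hle)

end Transfer

/-! ### Ordered spectral and singular value decompositions. -/

section SpectralSVD

theorem exists_orthogonal_antitone_diagonal {n : ℕ} {A : Matrix (Fin n) (Fin n) ℝ}
    (hA : A.IsHermitian) :
    ∃ U ∈ Matrix.orthogonalGroup (Fin n) ℝ, ∃ d : Fin n → ℝ,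
      Antitone d ∧ A = U * Matrix.diagonal d * Uᵀ := by
  set W : Matrix (Fin n) (Fin n) ℝ := hA.eigenvectorUnitary.1 with hW
  have hWW : Wᵀ * W = 1 := (Matrix.mem_orthogonalGroup_iff' _ _).1 hA.eigenvectorUnitary.2
  have hsp : A = W * Matrix.diagonal hA.eigenvalues * Wᵀ := by
    conv_lhs => rw [hA.spectral_theorem]
    rw [Unitary.conjStarAlgAut_apply]
    rfl
  set σ := Tuple.sort (fun i => -hA.eigenvalues i) with hσ
  have hs : Antitone (hA.eigenvalues ∘ σ) := fun i j hij => by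
    have := Tuple.monotone_sort (fun i => -hA.eigenvalues i) hij
    simpa using this
  refine ⟨W.submatrix id σ, ?_, hA.eigenvalues ∘ σ, hs, ?_⟩
  · rw [Matrix.mem_orthogonalGroup_iff', Matrix.transpose_submatrix]
    rw [← Matrix.submatrix_mul _ _ _ _ _ Function.bijective_id, hWW,
      Matrix.submatrix_one_equiv]
  · rw [Matrix.transpose_submatrix, ← Matrix.submatrix_diagonal_equiv,
      ← Matrix.submatrix_mul _ _ _ _ _ σ.bijective, ← Matrix.submatrix_mul _ _ _ _ _ σ.bijective,
      ← hsp]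
    rfl

/-- The rectangular `m × n` matrix with diagonal `c` followed by zeros. -/
noncomputable def rectDiagonal {m n r : ℕ} (c : Fin r → ℝ) : Matrix (Fin m) (Fin n) ℝ :=
  Matrix.of fun i j => if i.val = j.val then if h : i.val < r then c ⟨i.val, h⟩ else 0 else 0

lemma orthogonal_of_orthonormalBasis {n : ℕ}
    (b : OrthonormalBasis (Fin n) ℝ (EuclideanSpace ℝ (Fin n))) :
    Matrix.of (fun i j => b j i) ∈ Matrix.orthogonalGroup (Fin n) ℝ := by
  rw [Matrix.mem_orthogonalGroup_iff']
  ext i j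
  have := orthonormal_iff_ite.1 b.orthonormal i j
  simp only [PiLp.inner_apply, RCLike.inner_apply, conj_trivial] at this
  simp only [Matrix.mul_apply, Matrix.transpose_apply, Matrix.of_apply, Matrix.one_apply]
  rw [← this]
  exact Finset.sum_congr rfl fun k _ => mul_comm _ _

/-- Singular value decomposition of a strict contraction. -/
theorem exists_singularValueDecomposition {m n : ℕ} (M : Matrix (Fin m) (Fin n) ℝ)
    (hM : (1 - Mᵀ * M).PosDef) :
    ∃ r ≤ m, r ≤ n ∧ ∃ c : Fin r → ℝ, Antitone c ∧ (∀ i, c i ∈ Set.Ioo (0 : ℝ) 1) ∧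
      ∃ U ∈ Matrix.orthogonalGroup (Fin m) ℝ, ∃ V ∈ Matrix.orthogonalGroup (Fin n) ℝ,
        M = U * (rectDiagonal c : Matrix (Fin m) (Fin n) ℝ) * Vᵀ := by
  have hps : (Mᵀ * M).PosSemidef := Matrix.posSemidef_conjTranspose_mul_self M
  obtain ⟨V, hV, d, hd, hVd⟩ := exists_orthogonal_antitone_diagonal hps.1
  have hVV : Vᵀ * V = 1 := (Matrix.mem_orthogonalGroup_iff' _ _).1 hV
  have hVV' : V * Vᵀ = 1 := (Matrix.mem_orthogonalGroup_iff _ _).1 hV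
  set W := M * V with hW
  have hWW : Wᵀ * W = Matrix.diagonal d := by
    calc Wᵀ * W = Vᵀ * (Mᵀ * M) * V := by
          rw [hW, Matrix.transpose_mul]; simp only [Matrix.mul_assoc]
      _ = (Vᵀ * V) * Matrix.diagonal d * (Vᵀ * V) := by
          rw [hVd]; simp only [Matrix.mul_assoc]
      _ = _ := by rw [hVV]; simp
  have hcol : ∀ j k, ∑ i, W i j * W i k = if j = k then d j else 0 := by
    intro j k
    have := congrFun (congrFun hWW j) k
    rwa [Matrix.mul_apply, Matrix.diagonal_apply] at this
  have hd0 : ∀ j, 0 ≤ d j := by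
    intro j
    have := hcol j j
    rw [if_pos rfl] at this
    rw [← this]
    exact Finset.sum_nonneg fun i _ => mul_self_nonneg _
  have hd1 : ∀ j, d j < 1 := by
    have h1 : (Vᵀ * (1 - Mᵀ * M) * V).PosDef := by
      have hu : IsUnit V := ⟨⟨V, Vᵀ, hVV', hVV⟩, rfl⟩
      have := (Matrix.IsUnit.posDef_star_left_conjugate_iff hu (x := 1 - Mᵀ * M)).2 hM
      exact this
    have h2 : Vᵀ * (1 - Mᵀ * M) * V = Matrix.diagonal fun j => 1 - d j := by
      rw [mul_sub, sub_mul, mul_one, hVV]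
      rw [show Vᵀ * (Mᵀ * M) * V = Matrix.diagonal d by
        rw [← hWW, hW, Matrix.transpose_mul]; simp only [Matrix.mul_assoc]]
      rw [← Matrix.diagonal_one, Matrix.diagonal_sub]
    rw [h2, Matrix.posDef_diagonal_iff] at h1
    intro j
    linarith [h1 j]
  -- As d is nonincreasing, its positive entries form an initial segment; r is its length, the rank.
  obtain ⟨r, hrn, hr⟩ : ∃ r ≤ n, ∀ j : Fin n, 0 < d j ↔ j.val < r := by
    by_cases h : ∃ j : ℕ, ∃ hj : j < n, d ⟨j, hj⟩ ≤ 0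
    · classical
      refine ⟨Nat.find h, (Nat.find_spec h).choose.le, fun j => ⟨fun hj => ?_, fun hj => ?_⟩⟩
      · by_contra hlt
        obtain ⟨hk, hk0⟩ := Nat.find_spec h
        have : d j ≤ d ⟨Nat.find h, hk⟩ := hd (Fin.mk_le_of_le_val (not_lt.1 hlt))
        linarith
      · by_contra h0
        exact Nat.find_min h hj ⟨j.2, not_lt.1 h0⟩
    · push Not at h
      exact ⟨n, le_rfl, fun j => ⟨fun _ => j.2, fun _ => h j j.2⟩⟩
  let c : Fin r → ℝ := fun i => √(d ⟨i, i.2.trans_le hrn⟩)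
  have hc0 : ∀ i, 0 < c i := fun i => Real.sqrt_pos.2 ((hr _).2 i.2)
  have hcc : ∀ i : Fin r, c i * c i = d ⟨i, i.2.trans_le hrn⟩ := fun i =>
    Real.mul_self_sqrt (hd0 _)
  -- The left singular vectors are the normalized nonzero columns of M V; they are completed below
  -- to an orthonormal basis.
  let u : Fin r → EuclideanSpace ℝ (Fin m) := fun j =>
    WithLp.toLp 2 fun i => (c j)⁻¹ * W i ⟨j, j.2.trans_le hrn⟩
  have hu : Orthonormal ℝ u := by
    rw [orthonormal_iff_ite]
    intro j k
    have e : inner ℝ (u j) (u k) = (c j)⁻¹ * (c k)⁻¹ *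
        ∑ i, W i ⟨j, j.2.trans_le hrn⟩ * W i ⟨k, k.2.trans_le hrn⟩ := by
      simp only [u, PiLp.inner_apply, RCLike.inner_apply, conj_trivial, Finset.mul_sum]
      exact Finset.sum_congr rfl fun i _ => by ring
    rw [e, hcol]
    by_cases hjk : j = k
    · subst hjk
      rw [if_pos rfl, if_pos rfl, ← hcc]
      have := (hc0 j).ne'
      field_simp
    · rw [if_neg hjk, if_neg (by simpa [Fin.ext_iff] using hjk), mul_zero]
  have hrm : r ≤ m := by
    simpa using hu.linearIndependent.fintype_card_le_finrank
  let v : Fin m → EuclideanSpace ℝ (Fin m) := fun i => if h : i.val < r then u ⟨i, h⟩ else 0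
  have hv : Orthonormal ℝ (Set.domRestrict {i : Fin m | i.val < r} v) := by
    have : Set.domRestrict {i : Fin m | i.val < r} v =
        u ∘ fun i : {i : Fin m | i.val < r} => ⟨i.1.val, i.2⟩ := by
      ext i : 1
      exact dif_pos i.2
    rw [this]
    refine hu.comp _ fun a b hab => ?_
    exact Subtype.ext (Fin.ext (by simpa using hab))
  obtain ⟨b, hb⟩ := hv.exists_orthonormalBasis_extension_of_card_eq (by simp)
  refine ⟨r, hrm, hrn, c, fun i j hij => Real.sqrt_le_sqrt (hd hij), fun i => ⟨hc0 i, ?_⟩,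
    _, orthogonal_of_orthonormalBasis b, V, hV, ?_⟩
  · rw [Real.sqrt_lt' one_pos, one_pow]
    exact hd1 _
  have key : W = Matrix.of (fun i j => b j i) *
      (rectDiagonal c : Matrix (Fin m) (Fin n) ℝ) := by
    ext i j
    rw [Matrix.mul_apply]
    simp only [rectDiagonal, Matrix.of_apply]
    by_cases hj : j.val < r
    · rw [Finset.sum_eq_single (⟨j, hj.trans_le hrm⟩ : Fin m)]
      · rw [hb _ hj]
        have := (hc0 ⟨j, hj⟩).ne'
        simp only [v, hj, u, dite_true, if_true]
        field_simp
      · intro k _ hk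
        rw [if_neg (by simpa [Fin.ext_iff] using hk), mul_zero]
      · simp
    -- A column of index at least r has norm zero, hence vanishes.
    · have h0 : ∑ i, W i j * W i j = 0 := by
        rw [hcol, if_pos rfl]
        exact le_antisymm (not_lt.1 (mt (hr j).1 hj)) (hd0 j)
      have h1 := (Finset.sum_eq_zero_iff_of_nonneg fun i _ => mul_self_nonneg _).1 h0 i
        (Finset.mem_univ i)
      rw [mul_self_eq_zero.1 h1]
      refine (Finset.sum_eq_zero fun k _ => ?_).symm
      by_cases hk : k.val = j.val
      · rw [if_pos hk, dif_neg (by omega), mul_zero]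
      · rw [if_neg hk, mul_zero]
  rw [← key, hW, Matrix.mul_assoc, hVV', Matrix.mul_one]

end SpectralSVD

/-! ### The canonical variable form and its invariants. -/

section CanonicalForm

lemma diagonal_invSqrt_normalizes {n : ℕ} {d : Fin n → ℝ} (hd : ∀ i, 0 < d i) :
    Matrix.diagonal (fun i => (√(d i))⁻¹) * Matrix.diagonal d *
      Matrix.diagonal (fun i => (√(d i))⁻¹) = 1 := by
  rw [Matrix.diagonal_mul_diagonal, Matrix.diagonal_mul_diagonal, ← Matrix.diagonal_one]
  congr 1
  ext i
  have h := (Real.sqrt_pos.2 (hd i)).ne'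
  have h2 := Real.mul_self_sqrt (hd i).le
  field_simp
  rw [sq, h2]

lemma whiten_block {n : ℕ} {U : Matrix (Fin n) (Fin n) ℝ}
    (hU : U ∈ Matrix.orthogonalGroup (Fin n) ℝ) {d : Fin n → ℝ} (hd : ∀ i, 0 < d i) :
    Matrix.diagonal (fun i => (√(d i))⁻¹) * Uᵀ * (U * Matrix.diagonal d * Uᵀ) *
      (Matrix.diagonal (fun i => (√(d i))⁻¹) * Uᵀ)ᵀ = 1 := by
  have hUU : Uᵀ * U = 1 := (Matrix.mem_orthogonalGroup_iff' _ _).1 hU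
  rw [Matrix.transpose_mul, Matrix.transpose_transpose, Matrix.diagonal_transpose]
  calc _ = Matrix.diagonal (fun i => (√(d i))⁻¹) * (Uᵀ * U) * Matrix.diagonal d * (Uᵀ * U) *
        Matrix.diagonal (fun i => (√(d i))⁻¹) := by simp only [Matrix.mul_assoc]
    _ = 1 := by rw [hUU, mul_one, mul_one, diagonal_invSqrt_normalizes hd]

lemma eq_fromBlocks_of_isHermitian {p₁ p₂ : ℕ}
    {S : Matrix (Fin p₁ ⊕ Fin p₂) (Fin p₁ ⊕ Fin p₂) ℝ} (hS : S.IsHermitian) :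
    S = Matrix.fromBlocks S.toBlocks₁₁ S.toBlocks₁₂ S.toBlocks₁₂ᵀ S.toBlocks₂₂ := by
  conv_lhs => rw [← Matrix.fromBlocks_toBlocks S]
  congr 1
  ext i j
  have := hS.apply (Sum.inr i) (Sum.inl j)
  simpa [Matrix.toBlocks₂₁, Matrix.toBlocks₁₂] using this.symm

lemma fromBlocks_conj {p₁ p₂ : ℕ} (A : Matrix (Fin p₁) (Fin p₁) ℝ)
    (B : Matrix (Fin p₂) (Fin p₂) ℝ) (S₁ : Matrix (Fin p₁) (Fin p₁) ℝ)
    (C : Matrix (Fin p₁) (Fin p₂) ℝ) (S₂ : Matrix (Fin p₂) (Fin p₂) ℝ) :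
    Matrix.fromBlocks A 0 0 B * Matrix.fromBlocks S₁ C Cᵀ S₂ * (Matrix.fromBlocks A 0 0 B)ᵀ =
      Matrix.fromBlocks (A * S₁ * Aᵀ) (A * C * Bᵀ) (A * C * Bᵀ)ᵀ (B * S₂ * Bᵀ) := by
  simp [Matrix.fromBlocks_transpose, Matrix.fromBlocks_multiply, Matrix.transpose_mul,
    Matrix.mul_assoc]

variable {p₁ p₂ : ℕ} {S : Matrix (Fin p₁ ⊕ Fin p₂) (Fin p₁ ⊕ Fin p₂) ℝ} {θ : CvfParams p₁ p₂}
  {U : CvfBases p₁ p₂}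

theorem IsCvf.transform (h : IsCvf S θ U) :
    cvfTransform θ U * S * (cvfTransform θ U)ᵀ = θ.Qcvf := by
  have h3 : U.U₃ᵀ * U.U₃ = 1 := (Matrix.mem_orthogonalGroup_iff' _ _).1 U.orth₃
  have h4 : U.U₄ᵀ * U.U₄ = 1 := (Matrix.mem_orthogonalGroup_iff' _ _).1 U.orth₄
  have w1 := whiten_block U.orth₁ h.d₁_pos
  have w2 := whiten_block U.orth₂ h.d₂_pos
  have e1 : U.U₃ᵀ * θ.D₁InvSqrt * U.U₁ᵀ * S.toBlocks₁₁ *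
      (U.U₃ᵀ * θ.D₁InvSqrt * U.U₁ᵀ)ᵀ = 1 := by
    rw [h.svd₁]
    calc _ = U.U₃ᵀ * (θ.D₁InvSqrt * U.U₁ᵀ * (U.U₁ * θ.D₁ * U.U₁ᵀ) *
          (θ.D₁InvSqrt * U.U₁ᵀ)ᵀ) * U.U₃ := by
            simp only [Matrix.transpose_mul, Matrix.transpose_transpose, Matrix.mul_assoc]
      _ = 1 := by
        rw [CvfParams.D₁InvSqrt, CvfParams.D₁, w1, mul_one, h3]
  have e2 : U.U₄ᵀ * θ.D₂InvSqrt * U.U₂ᵀ * S.toBlocks₂₂ *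
      (U.U₄ᵀ * θ.D₂InvSqrt * U.U₂ᵀ)ᵀ = 1 := by
    rw [h.svd₂]
    calc _ = U.U₄ᵀ * (θ.D₂InvSqrt * U.U₂ᵀ * (U.U₂ * θ.D₂ * U.U₂ᵀ) *
          (θ.D₂InvSqrt * U.U₂ᵀ)ᵀ) * U.U₄ := by
            simp only [Matrix.transpose_mul, Matrix.transpose_transpose, Matrix.mul_assoc]
      _ = 1 := by
        rw [CvfParams.D₂InvSqrt, CvfParams.D₂, w2, mul_one, h4]
  have e3 : U.U₃ᵀ * θ.D₁InvSqrt * U.U₁ᵀ * S.toBlocks₁₂ *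
      (U.U₄ᵀ * θ.D₂InvSqrt * U.U₂ᵀ)ᵀ = θ.D₃ := by
    calc _ = U.U₃ᵀ * (θ.D₁InvSqrt * U.U₁ᵀ * S.toBlocks₁₂ * U.U₂ * θ.D₂InvSqrt) * U.U₄ := by
            simp only [Matrix.transpose_mul, Matrix.transpose_transpose, Matrix.mul_assoc,
              CvfParams.D₂InvSqrt, Matrix.diagonal_transpose]
      _ = (U.U₃ᵀ * U.U₃) * θ.D₃ * (U.U₄ᵀ * U.U₄) := by
        rw [h.svd₃]; simp only [Matrix.mul_assoc]
      _ = θ.D₃ := by rw [h3, h4, Matrix.one_mul, Matrix.mul_one]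
  conv_lhs => rw [eq_fromBlocks_of_isHermitian h.posDef.1]
  rw [cvfTransform, fromBlocks_conj, e1, e2, e3, CvfParams.Qcvf]

/-- Take determinants in the transformation identity; each orthogonal factor occurs twice and
contributes (±1)² = 1. -/
theorem IsCvf.det_eq (h : IsCvf S θ U) :
    θ.D₁.det * θ.D₂.det * θ.Qcvf.det = S.det := by
  have ho : ∀ {n : ℕ} {A : Matrix (Fin n) (Fin n) ℝ}, A ∈ Matrix.orthogonalGroup (Fin n) ℝ →
      A.det * A.det = 1 := by
    intro n A hA
    have := congrArg Matrix.det ((Matrix.mem_orthogonalGroup_iff' _ _).1 hA)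
    simpa using this
  have n1 := congrArg Matrix.det (diagonal_invSqrt_normalizes h.d₁_pos)
  have n2 := congrArg Matrix.det (diagonal_invSqrt_normalizes h.d₂_pos)
  have ht := congrArg Matrix.det h.transform
  rw [Matrix.det_mul, Matrix.det_mul, Matrix.det_transpose, cvfTransform,
    Matrix.det_fromBlocks_zero₂₁] at ht
  simp only [Matrix.det_mul, Matrix.det_transpose, Matrix.det_one] at ht n1 n2
  rw [← ht]
  have o1 := ho U.orth₁
  have o2 := ho U.orth₂
  have o3 := ho U.orth₃
  have o4 := ho U.orth₄
  simp only [CvfParams.D₁, CvfParams.D₂, CvfParams.D₁InvSqrt, CvfParams.D₂InvSqrt]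
  generalize (Matrix.diagonal fun i => (√(θ.d₁ i))⁻¹).det = a at *
  generalize (Matrix.diagonal fun i => (√(θ.d₂ i))⁻¹).det = b at *
  calc _ = (a * (Matrix.diagonal θ.d₁).det * a) * (b * (Matrix.diagonal θ.d₂).det * b) *
        (U.U₁.det * U.U₁.det) * (U.U₂.det * U.U₂.det) * (U.U₃.det * U.U₃.det) *
        (U.U₄.det * U.U₄.det) * S.det := by ring
    _ = S.det := by rw [n1, n2, o1, o2, o3, o4]; ring

theorem IsCvf.trace_eq (h : IsCvf S θ U) :
    S.toBlocks₁₁.trace = ∑ i, θ.d₁ i ∧ S.toBlocks₂₂.trace = ∑ i, θ.d₂ i := by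
  have h1 : U.U₁ᵀ * U.U₁ = 1 := (Matrix.mem_orthogonalGroup_iff' _ _).1 U.orth₁
  have h2 : U.U₂ᵀ * U.U₂ = 1 := (Matrix.mem_orthogonalGroup_iff' _ _).1 U.orth₂
  rw [h.svd₁, h.svd₂, Matrix.trace_mul_comm, ← Matrix.mul_assoc, h1,
    Matrix.trace_mul_comm (U.U₂ * θ.D₂), ← Matrix.mul_assoc, h2, one_mul, one_mul,
    CvfParams.D₁, CvfParams.D₂, Matrix.trace_diagonal, Matrix.trace_diagonal]
  exact ⟨rfl, rfl⟩

/-- The Schur complement, obtained by congruence with the injective block column (−M; 1). -/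
lemma posDef_one_sub_transpose_mul_self {m n : ℕ} {M : Matrix (Fin m) (Fin n) ℝ}
    (h : (Matrix.fromBlocks 1 M Mᵀ 1).PosDef) : (1 - Mᵀ * M).PosDef := by
  let B : Matrix (Fin m ⊕ Fin n) (Fin n) ℝ := Matrix.fromRows (-M) 1
  have hB : Function.Injective B.mulVec := by
    intro x y hxy
    simp only [B, Matrix.fromRows_mulVec] at hxy
    simpa using congrArg (fun f => f ∘ Sum.inr) hxy
  have e : Bᴴ * Matrix.fromBlocks 1 M Mᵀ 1 * B = 1 - Mᵀ * M := by
    rw [Matrix.mul_assoc, Matrix.fromBlocks_mul_fromRows,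
      Matrix.conjTranspose_eq_transpose_of_trivial, Matrix.transpose_fromRows,
      Matrix.fromCols_mul_fromRows]
    simp
    abel
  rw [← e]
  exact h.conjTranspose_mul_mul_same hB

/-- Whitening the diagonal blocks keeps S positive definite, so by the Schur complement the whitened
cross block is a strict contraction. Its singular values lie below 1, which allows `p11 = 0`. -/
theorem exists_isCvf (hS : S.PosDef) :
    ∃ (θ : CvfParams p₁ p₂) (U : CvfBases p₁ p₂), IsCvf S θ U ∧ θ.p11 = 0 := by
  have hS1 : S.toBlocks₁₁.PosDef := hS.submatrix Sum.inl_injective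
  have hS2 : S.toBlocks₂₂.PosDef := hS.submatrix Sum.inr_injective
  obtain ⟨U₁, hU₁, d₁, hd₁, e₁⟩ := exists_orthogonal_antitone_diagonal hS1.1
  obtain ⟨U₂, hU₂, d₂, hd₂, e₂⟩ := exists_orthogonal_antitone_diagonal hS2.1
  have hpos : ∀ {n : ℕ} {A V : Matrix (Fin n) (Fin n) ℝ} {d : Fin n → ℝ}, A.PosDef →
      V ∈ Matrix.orthogonalGroup (Fin n) ℝ → A = V * Matrix.diagonal d * Vᵀ → ∀ i, 0 < d i := by
    intro n A V d hA hV e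
    have hu : IsUnit V := ⟨⟨V, Vᵀ, (Matrix.mem_orthogonalGroup_iff _ _).1 hV,
      (Matrix.mem_orthogonalGroup_iff' _ _).1 hV⟩, rfl⟩
    rw [e] at hA
    exact Matrix.posDef_diagonal_iff.1 ((Matrix.IsUnit.posDef_star_right_conjugate_iff hu).1 hA)
  have p1 := hpos hS1 hU₁ e₁
  have p2 := hpos hS2 hU₂ e₂
  set E₁ := Matrix.diagonal (fun i => (√(d₁ i))⁻¹) with hE₁
  set E₂ := Matrix.diagonal (fun i => (√(d₂ i))⁻¹) with hE₂
  set M := E₁ * U₁ᵀ * S.toBlocks₁₂ * U₂ * E₂ with hM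
  have hN : (Matrix.fromBlocks 1 M Mᵀ 1).PosDef := by
    have w1 := whiten_block hU₁ p1
    have w2 := whiten_block hU₂ p2
    rw [← e₁] at w1
    rw [← e₂] at w2
    have e : Matrix.fromBlocks (E₁ * U₁ᵀ) 0 0 (E₂ * U₂ᵀ) * S *
        star (Matrix.fromBlocks (E₁ * U₁ᵀ) 0 0 (E₂ * U₂ᵀ)) = Matrix.fromBlocks 1 M Mᵀ 1 := by
      rw [Matrix.star_eq_conjTranspose, Matrix.conjTranspose_eq_transpose_of_trivial]
      conv_lhs => rw [eq_fromBlocks_of_isHermitian hS.1]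
      rw [fromBlocks_conj, w1, w2]
      have : E₁ * U₁ᵀ * S.toBlocks₁₂ * (E₂ * U₂ᵀ)ᵀ = M := by
        simp [hM, hE₂, Matrix.mul_assoc, Matrix.transpose_mul]
      rw [this]
    have hu : IsUnit (Matrix.fromBlocks (E₁ * U₁ᵀ) 0 0 (E₂ * U₂ᵀ)) := by
      rw [Matrix.isUnit_fromBlocks_zero₂₁]
      exact ⟨IsUnit.of_mul_eq_one _ ((Matrix.mul_assoc _ _ _).symm.trans w1),
        IsUnit.of_mul_eq_one _ ((Matrix.mul_assoc _ _ _).symm.trans w2)⟩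
    rw [← e]
    exact (Matrix.IsUnit.posDef_star_right_conjugate_iff hu).2 hS
  obtain ⟨r, hr1, hr2, c, hc, hc01, U₃, hU₃, U₄, hU₄, e₃⟩ :=
    exists_singularValueDecomposition M (posDef_one_sub_transpose_mul_self hN)
  let θ : CvfParams p₁ p₂ :=
    { p11 := 0, p12 := r, p13 := p₁ - r, p23 := p₂ - r, dim₁ := by omega, dim₂ := by omega
      d₁ := d₁, d₂ := d₂, d₄ := c }
  have hD₃ : θ.D₃ = rectDiagonal c := by
    ext i j
    simp [CvfParams.D₃, rectDiagonal, θ]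
  refine ⟨θ, ⟨U₁, U₂, U₃, U₄, hU₁, hU₂, hU₃, hU₄⟩,
    ⟨hS, p1, p2, hc01, hd₁, hd₂, hc, e₁, e₂, ?_⟩, rfl⟩
  rw [hD₃]
  exact e₃

variable {Q : Matrix (Fin p₁ ⊕ Fin p₂) (Fin p₁ ⊕ Fin p₂) ℝ} {Δ₁ Δ₂ : ℝ≥0}

/-- Matrices sharing canonical parameters share objective and traces, so the infimum descends to
parameters; singular S contribute only ⊤. -/
theorem iInf_feasibleCov_eq_iInf_feasibleParams (hθ : IsCvf Q θ U) :
    ⨅ S ∈ feasibleCov Q Δ₁ Δ₂, halfLogDetRatio Q S =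
      ⨅ η ∈ feasibleParams Q Δ₁ Δ₂,
        ((1 / 2 * Real.log ((θ.D₁.det * θ.D₂.det * θ.Qcvf.det) /
          (η.D₁.det * η.D₂.det * η.Qcvf.det)) : ℝ) : EReal) := by
  rw [hθ.det_eq]
  refine le_antisymm (le_iInf₂ fun η hη => ?_) (le_iInf₂ fun S hS => ?_)
  · obtain ⟨-, t1, t2, S, V, hSV, hQS⟩ := hη
    rw [hSV.det_eq]
    refine (iInf₂_le S ⟨hSV.posDef.posSemidef, hQS, ?_, ?_⟩).trans ?_
    · rw [halfLogDetRatio, if_neg hSV.posDef.det_pos.ne']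
    · rwa [hSV.trace_eq.1]
    · rwa [hSV.trace_eq.2]
  · obtain ⟨hS0, hQS, t1, t2⟩ := hS
    by_cases hdet : S.det = 0
    · simp [halfLogDetRatio, hdet]
    obtain ⟨η, V, hη, h0⟩ := exists_isCvf (hS0.posDef_iff_det_ne_zero.2 hdet)
    rw [halfLogDetRatio, if_neg hdet, ← hη.det_eq]
    exact iInf₂_le η ⟨h0, hη.trace_eq.1 ▸ t1, hη.trace_eq.2 ▸ t2, S, V, hη, hQS⟩

lemma CvfParams.det_Qcvf (θ : CvfParams p₁ p₂) :
    θ.Qcvf.det = (1 - θ.D₃ * θ.D₃ᵀ).det :=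
  Matrix.det_fromBlocks_one₂₂ _ _ _

lemma CvfParams.det_Qcvf_eq_prod (θ : CvfParams p₁ p₂) (h : θ.p11 = 0) :
    θ.Qcvf.det = ∏ i, (1 - θ.d₄ i ^ 2) := by
  obtain ⟨p11, p12, p13, p23, dim₁, dim₂, d₁, d₂, d₄⟩ := θ
  simp only at h
  subst h
  simp only [Nat.zero_add] at dim₁ dim₂
  -- With the dimensions literally sums, indices split by `Fin.addCases` into the correlated block
  -- and the zero block.
  subst dim₁ dim₂
  rw [CvfParams.det_Qcvf]
  set θ : CvfParams (p12 + p13) (p12 + p23) := ⟨0, p12, p13, p23, _, _, d₁, d₂, d₄⟩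
  have hD : θ.D₃ * θ.D₃ᵀ =
      Matrix.diagonal (Fin.append (fun i => d₄ i ^ 2) (fun _ : Fin p13 => 0)) := by
    ext i j
    rw [Matrix.mul_apply, Matrix.diagonal_apply]
    simp only [CvfParams.D₃, Matrix.transpose_apply, Matrix.of_apply, θ, Nat.not_lt_zero,
      if_false, Nat.sub_zero]
    refine Fin.addCases (fun i => ?_) (fun i => ?_) i
    · rw [Fin.append_left, Finset.sum_eq_single (Fin.castAdd p23 i)]
      · by_cases hij : Fin.castAdd p13 i = j
        · subst hij
          simp [sq]
        · have : ¬ j.val = i.val := fun h => hij (Fin.ext (by simpa using h.symm))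
          simp [hij, this]
      · intro k _ hk
        have : ¬ i.val = k.val := fun h => hk (Fin.ext (by simpa using h.symm))
        simp [this]
      · simp
    · rw [Fin.append_right]
      simp
  rw [hD, ← Matrix.diagonal_one, Matrix.diagonal_sub, Matrix.det_diagonal, Fin.prod_univ_add]
  simp [θ]

end CanonicalForm

end JointRDF

theorem mainTheorem4 {Ω : Type*} [MeasurableSpace Ω] (P : Measure Ω) [IsProbabilityMeasure P]
    (p₁ p₂ : ℕ) (hp₁ : 0 < p₁) (hp₂ : 0 < p₂)
    (Q : Matrix (Fin p₁ ⊕ Fin p₂) (Fin p₁ ⊕ Fin p₂) ℝ) (hQ : Q.PosDef)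
    (X₁ : Ω → EuclideanSpace ℝ (Fin p₁)) (X₂ : Ω → EuclideanSpace ℝ (Fin p₂))
    (hX : HasLaw (fun ω => JointRDF.stack (X₁ ω) (X₂ ω)) (multivariateGaussian 0 Q) P)
    (Δ₁ Δ₂ : ℝ≥0) :
    -- the canonical variable form, with `p₁₁ = p₂₁ = 0`, of every nonsingular variance matrix
    -- (of the source, of the error) exists
    (∀ S : Matrix (Fin p₁ ⊕ Fin p₂) (Fin p₁ ⊕ Fin p₂) ℝ, S.PosDef →
      ∃ θ U, JointRDF.IsCvf S θ U ∧ θ.p11 = 0) ∧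
    -- the algorithm does transform the variance matrix to the canonical variable form
    (∀ (S : Matrix (Fin p₁ ⊕ Fin p₂) (Fin p₁ ⊕ Fin p₂) ℝ) θ U, JointRDF.IsCvf S θ U →
      JointRDF.cvfTransform θ U * S * (JointRDF.cvfTransform θ U)ᵀ = θ.Qcvf) ∧
    -- the joint RDF in terms of error covariances
    ((JointRDF.jointRDF (P.map fun ω => (X₁ ω, X₂ ω)) JointRDF.sqDist JointRDF.sqDist Δ₁ Δ₂ :
        ℝ≥0∞) : EReal) =
      (⨅ S ∈ JointRDF.feasibleCov Q Δ₁ Δ₂, JointRDF.halfLogDetRatio Q S) ∧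
    -- the joint RDF in terms of canonical parameters
    (∀ θ U, JointRDF.IsCvf Q θ U → θ.p11 = 0 →
      p₁ = θ.p12 + θ.p13 ∧ p₂ = θ.p12 + θ.p23 ∧
      ((JointRDF.jointRDF (P.map fun ω => (X₁ ω, X₂ ω)) JointRDF.sqDist JointRDF.sqDist Δ₁ Δ₂ :
          ℝ≥0∞) : EReal) =
        ⨅ η ∈ JointRDF.feasibleParams Q Δ₁ Δ₂,
          ((1 / 2 * Real.log ((θ.D₁.det * θ.D₂.det * θ.Qcvf.det) /
            (η.D₁.det * η.D₂.det * η.Qcvf.det)) : ℝ) : EReal)) ∧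
    -- the shape and the determinant of the canonical form of the error covariance
    (∀ η ∈ JointRDF.feasibleParams Q Δ₁ Δ₂,
      p₁ = η.p12 + η.p13 ∧ p₂ = η.p12 + η.p23 ∧
      η.Qcvf.det = (1 - η.D₃ * η.D₃ᵀ).det ∧
      (0 < η.p13 → 0 < η.p23 → η.p12 = 0 → η.Qcvf.det = 1) ∧
      η.Qcvf.det = ∏ i, (1 - η.d₄ i ^ 2)) := by
  -- Measurability of the pair is recovered from that of the stacked vector.
  have hm : AEMeasurable (fun ω => (X₁ ω, X₂ ω)) P :=
    JointRDF.measurable_unstack.comp_aemeasurable hX.aemeasurable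
  have : IsProbabilityMeasure (P.map fun ω => (X₁ ω, X₂ ω)) :=
    Measure.isProbabilityMeasure_map hm
  have hμ : (P.map fun ω => (X₁ ω, X₂ ω)).map (fun z => JointRDF.stack z.1 z.2) =
      multivariateGaussian 0 Q := by
    rw [AEMeasurable.map_map_of_aemeasurable JointRDF.measurable_stack.aemeasurable hm]
    exact hX.map_eq
  have hrdf := JointRDF.jointRDF_eq_iInf_feasibleCov (Δ₁ := Δ₁) (Δ₂ := Δ₂) hQ hμ
  refine ⟨fun S hS => JointRDF.exists_isCvf hS, fun S θ U h => h.transform, hrdf,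
    fun θ U h h0 => ⟨?_, ?_, ?_⟩, fun η hη => ⟨?_, ?_, η.det_Qcvf, fun _ _ h0 => ?_,
      η.det_Qcvf_eq_prod hη.1⟩⟩
  · have := θ.dim₁
    omega
  · have := θ.dim₂
    omega
  · rw [hrdf, JointRDF.iInf_feasibleCov_eq_iInf_feasibleParams h]
  · have := η.dim₁
    have := hη.1
    omega
  · have := η.dim₂
    have := hη.1
    omega
  · rw [η.det_Qcvf_eq_prod hη.1]
    have : IsEmpty (Fin η.p12) := by rw [h0]; infer_instance
    exact Finset.prod_of_isEmpty _
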